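/- Rings are associative but not necessarily unital, and ring homomorphisms need not preserve units. For a ring $R$ let $M_\infty(R)$ be the ring of infinite matrices over $R$, indexed by the positive integers, with only finitely many nonzero entries. For $x,y\in M_\infty(R)$ write $x\precsim_1 y$ if $x=syt$ for some $s,t\in M_\infty(R)$. The ring $R$ is called \emph{dense} if whenever $x\precsim_1 y$ in $M_\infty(R)$ there is $z\in M_\infty(R)$ with $x\precsim_1 z\precsim_1 y$. It is called \emph{left normal} if for all $a,b,c\in M_\infty(R)$ with $a=ba$ and $b=cb$ there are $d,e\in M_\infty(R)$ with $a=da$, $d=ed$ and $e=ce$. Let $T(R)$ be the set of sequences $(x_n)$ in $M_\infty(R)$ with $x_n\precsim_1 x_{n+1}$ for all $n$, and let $\mathcal S(R)\subseteq T(R)$ consist of those for which, for every $n$, there is $y_{n+1}\in M_\infty(R)$ with $x_n=y_{n+1}x_{n+1}x_n$. Write $(x_n)\precsim (y_n)$ if for every $n$ there is $m$ with $x_n\precsim_1 y_m$, and $(x_n)\sim(y_n)$ if $(x_n)\precsim(y_n)\precsim(x_n)$. Let $\Lambda(R)=T(R)/{\sim}$, ordered by $\precsim$, with addition induced by the componentwise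 diagonal sum $(x_n\oplus y_n)$, and let $\mathrm S(R)\subseteq\Lambda(R)$ be the set of classes of sequences in $\mathcal S(R)$. In a partially ordered set, $x\ll y$ means that for every increasing sequence $(z_n)$ having a supremum with $y\le\sup_n z_n$ there is $m$ with $x\le z_m$. A $\mathrm{Cu}$-semigroup is a commutative monoid with a partial order compatible with addition in which $0$ is the least element, such that (O1) increasing sequences have suprema; (O2) every element is the supremum of a sequence $(x_n)$ with $x_n\ll x_{n+1}$ for all $n$; (O3) $x'\ll x$ and $y'\ll y$ imply $x'+y'\ll x+y$; (O4) $\sup_n(x_n+y_n)=\sup_n x_n+\sup_n y_n$ for increasing sequences $(x_n)$, $(y_n)$. A sequence $(x_n)$ is \emph{weakly increasing} if there is an increasing sequence $(y_m)$ such that every $y_m$ satisfies $y_m\le x_n$ for all large $n$, and $x_n\le\sup_m y_m$ for every $n$. The category $\mathrm{SCu}$ has as objects the pairs $(S,W)$ of a $\mathrm{Cu}$-semigroup $S$ and a submonoid $W\subseteq S$ closed under suprema of weakly increasing sequences of $S$; a morphism $(S_1,W_1)\to(S_2,W_2)$ is a monoid homomorphism $f\colon S_1\to S_2$ that preserves the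 order, the relation $\ll$ and suprema of increasing sequences, with $f(W_1)\subseteq W_2$. For a dense ring $R$, the pair $\mathrm{SCu}(R)=(\Lambda(R),\mathrm S(R))$ is an object of $\mathrm{SCu}$, and entrywise application of ring homomorphisms makes $R\mapsto\mathrm{SCu}(R)$ a functor from dense rings to $\mathrm{SCu}$. \textbf{Theorem.} Let $((R_\lambda)_{\lambda\in\Omega},(\phi_{\mu,\lambda})_{\mu\ge\lambda})$ be a direct system, over a directed set $\Omega$, of rings that are both dense and left normal, and let $R=\varinjlim R_\lambda$ be its direct limit in the category of rings, with limit maps $\phi_\lambda\colon R_\lambda\to R$. Then $R$ is dense, and $\mathrm{SCu}(R)$ together with the morphisms $\mathrm{SCu}(\phi_\lambda)\colon\mathrm{SCu}(R_\lambda)\to\mathrm{SCu}(R)$ is the direct limit of the system $(\mathrm{SCu}(R_\lambda),\mathrm{SCu}(\phi_{\mu,\lambda}))$ in the category $\mathrm{SCu}$. In particular $\varinjlim\mathrm{SCu}(R_\lambda)\cong\mathrm{SCu}(\varinjlim R_\lambda)$ in $\mathrm{SCu}$. -/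

import Mathlib

universe u v

open CategoryTheory CategoryTheory.Limits

namespace CuntzRing

/-! ### The ring of finitely supported infinite matrices -/

/-- `IsSupp x n`: all nonzero entries of the infinite matrix `x` lie in the top left
`n × n` corner, that is, `x` has a finite representative of size `n`. -/
def IsSupp {R : Type u} [NonUnitalRing R] (x : ℕ → ℕ → R) (n : ℕ) : Prop :=
  ∀ i j, n ≤ i ∨ n ≤ j → x i j = 0

/-- `M_∞(R)`, for a (not necessarily unital) ring `R`: the infinite matrices over `R` with only
finitely many nonzero entries. -/
structure MInf (R : Type u) [NonUnitalRing R] where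
  /-- The entries of the matrix. -/
  entry : ℕ → ℕ → R
  finite : ∃ n, IsSupp entry n

namespace MInf

variable {R : Type u} [NonUnitalRing R]

instance : CoeFun (MInf R) (fun _ => ℕ → ℕ → R) := ⟨entry⟩

@[ext] theorem ext {x y : MInf R} (h : ∀ i j, x i j = y i j) : x = y := by
  obtain ⟨x, hx⟩ := x
  obtain ⟨y, hy⟩ := y
  obtain rfl : x = y := funext fun i => funext fun j => h i j
  rfl

instance : Zero (MInf R) := ⟨⟨fun _ _ => 0, 0, fun _ _ _ => rfl⟩⟩

instance : Add (MInf R) where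
  add x y := ⟨fun i j => x i j + y i j, by
    obtain ⟨n, hn⟩ := x.finite
    obtain ⟨m, hm⟩ := y.finite
    refine ⟨max n m, fun i j h => ?_⟩
    dsimp only
    rw [hn i j (by omega), hm i j (by omega), add_zero]⟩

instance : Neg (MInf R) where
  neg x := ⟨fun i j => -x i j, by
    obtain ⟨n, hn⟩ := x.finite
    refine ⟨n, fun i j h => ?_⟩
    dsimp only
    rw [hn i j h, neg_zero]⟩

@[simp] theorem zero_apply (i j : ℕ) : (0 : MInf R) i j = 0 := rfl
@[simp] theorem add_apply (x y : MInf R) (i j : ℕ) : (x + y) i j = x i j + y i j := rfl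
@[simp] theorem neg_apply (x : MInf R) (i j : ℕ) : (-x) i j = -x i j := rfl

instance : AddCommGroup (MInf R) where
  add_assoc x y z := by ext i j; simp [add_assoc]
  zero_add x := by ext i j; simp
  add_zero x := by ext i j; simp
  neg_add_cancel x := by ext i j; simp
  add_comm x y := by ext i j; simp [add_comm]
  nsmul := nsmulRec
  zsmul := zsmulRec

theorem isSupp_mono {x : ℕ → ℕ → R} {n m : ℕ} (h : IsSupp x n) (hnm : n ≤ m) : IsSupp x m :=
  fun i j hij => h i j (by omega)

/-- Matrix multiplication; the sum has only finitely many nonzero terms. -/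
noncomputable instance : Mul (MInf R) where
  mul x y := ⟨fun i j => ∑ᶠ k, x i k * y k j, by
    obtain ⟨n, hn⟩ := x.finite
    obtain ⟨m, hm⟩ := y.finite
    refine ⟨max n m, fun i j h => ?_⟩
    have : ∀ k, x i k * y k j = 0 := by
      intro k
      rcases h with h | h
      · have : x i k = 0 := hn i k (by omega)
        simp [this]
      · have : y k j = 0 := hm k j (by omega)
        simp [this]
    simp [this]⟩

theorem mul_apply (x y : MInf R) (i j : ℕ) : (x * y) i j = ∑ᶠ k, x i k * y k j := rfl

theorem mul_apply_range {x : MInf R} {n : ℕ} (hx : IsSupp x n) (y : MInf R) (i j : ℕ) :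
    (x * y) i j = ∑ k ∈ Finset.range n, x i k * y k j := by
  rw [mul_apply]
  refine finsum_eq_sum_of_support_subset _ fun k hk => ?_
  simp only [Finset.coe_range, Set.mem_Iio]
  by_contra hlt
  exact hk (by simp [hx i k (by omega)])

theorem exists_common (x y z : MInf R) : ∃ n, IsSupp x n ∧ IsSupp y n ∧ IsSupp z n := by
  obtain ⟨a, ha⟩ := x.finite
  obtain ⟨b, hb⟩ := y.finite
  obtain ⟨c, hc⟩ := z.finite
  exact ⟨max a (max b c), isSupp_mono ha (by omega), isSupp_mono hb (by omega),
    isSupp_mono hc (by omega)⟩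

theorem isSupp_mul {x y : MInf R} {n : ℕ} (hx : IsSupp x n) (hy : IsSupp y n) :
    IsSupp (x * y : MInf R) n := by
  intro i j h
  rw [mul_apply_range hx]
  refine Finset.sum_eq_zero fun k _ => ?_
  rcases h with h | h
  · simp [hx i k (by omega)]
  · simp [hy k j (by omega)]

noncomputable instance : NonUnitalRing (MInf R) :=
  { (inferInstance : AddCommGroup (MInf R)), (inferInstance : Mul (MInf R)) with
    left_distrib := by
      intro x y z
      obtain ⟨n, hx, -, -⟩ := exists_common x y z
      ext i j
      simp only [add_apply, mul_apply_range hx, mul_add, Finset.sum_add_distrib]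
    right_distrib := by
      intro x y z
      obtain ⟨n, hx, hy, -⟩ := exists_common x y z
      have hxy : IsSupp (x + y : MInf R) n := fun i j h => by simp [hx i j h, hy i j h]
      ext i j
      simp only [add_apply, mul_apply_range hx, mul_apply_range hy, mul_apply_range hxy, add_mul,
        Finset.sum_add_distrib]
    zero_mul := by
      intro x
      ext i j
      simp [mul_apply]
    mul_zero := by
      intro x
      ext i j
      simp [mul_apply]
    mul_assoc := by
      intro x y z
      obtain ⟨n, hx, hy, hz⟩ := exists_common x y z
      ext i j
      rw [mul_apply_range (isSupp_mul hx hy), mul_apply_range hx]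
      simp only [mul_apply_range hx, mul_apply_range hy, Finset.sum_mul, Finset.mul_sum, mul_assoc]
      exact Finset.sum_comm }

/-- The ring homomorphism `M_∞(R) → M_∞(R')` induced by a ring homomorphism, entrywise. -/
noncomputable def map {R' : Type v} [NonUnitalRing R'] (f : R →ₙ+* R') : MInf R →ₙ+* MInf R' where
  toFun x := ⟨fun i j => f (x i j), by
    obtain ⟨n, hn⟩ := x.finite
    refine ⟨n, fun i j h => ?_⟩
    change f (x i j) = 0
    rw [hn i j h, map_zero]⟩
  map_zero' := by ext i j; exact map_zero f
  map_add' x y := by ext i j; exact map_add f _ _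
  map_mul' x y := by
    obtain ⟨n, hn⟩ := x.finite
    ext i j
    rw [mul_apply_range (n := n) (fun i j h => by
      change f (x i j) = 0
      rw [hn i j h, map_zero])]
    change f ((x * y) i j) = _
    rw [mul_apply_range hn, map_sum]
    exact Finset.sum_congr rfl fun k _ => map_mul f _ _

@[simp] theorem map_apply {R' : Type v} [NonUnitalRing R'] (f : R →ₙ+* R') (x : MInf R)
    (i j : ℕ) : map f x i j = f (x i j) := rfl

/-- The least size of a finite representative of `x`. -/
noncomputable def size (x : MInf R) : ℕ := sInf {n | IsSupp x n}

theorem isSupp_size (x : MInf R) : IsSupp x x.size := Nat.sInf_mem x.finite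

theorem size_le {x : MInf R} {n : ℕ} (h : IsSupp x n) : x.size ≤ n := Nat.sInf_le h

/-- The diagonal sum `x ⊕ y`: the block diagonal matrix with the least finite representative
of `x` in the top left corner, followed by `y`. -/
noncomputable def dsum (x y : MInf R) : MInf R :=
  ⟨fun i j => if i < x.size ∧ j < x.size then x i j
      else if x.size ≤ i ∧ x.size ≤ j then y (i - x.size) (j - x.size) else 0, by
    obtain ⟨m, hm⟩ := y.finite
    refine ⟨x.size + m, fun i j h => ?_⟩
    dsimp only
    rw [if_neg (by omega)]
    split_ifs with h2
    · exact hm _ _ (by omega)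
    · rfl⟩

theorem dsum_apply (x y : MInf R) (i j : ℕ) :
    dsum x y i j = if i < x.size ∧ j < x.size then x i j
      else if x.size ≤ i ∧ x.size ≤ j then y (i - x.size) (j - x.size) else 0 := rfl

theorem size_zero : (0 : MInf R).size = 0 :=
  Nat.le_zero.1 (size_le fun _ _ _ => rfl)

theorem size_dsum (x y : MInf R) : (dsum x y).size = x.size + y.size := by
  apply le_antisymm
  · refine size_le fun i j h => ?_
    rw [dsum_apply, if_neg (by omega)]
    split_ifs with h2
    · exact isSupp_size y _ _ (by omega)
    · rfl
  · have hd := isSupp_size (dsum x y)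
    have hx : x.size ≤ (dsum x y).size := by
      refine size_le fun i j h => ?_
      by_cases hij : i < x.size ∧ j < x.size
      · have := hd i j h
        rwa [dsum_apply, if_pos hij] at this
      · exact isSupp_size x i j (by omega)
    have hy : y.size ≤ (dsum x y).size - x.size := by
      refine size_le fun i j h => ?_
      have := hd (i + x.size) (j + x.size) (by omega)
      rw [dsum_apply, if_neg (by omega), if_pos (by omega)] at this
      simpa using this
    omega

theorem zero_dsum (x : MInf R) : dsum 0 x = x := by
  ext i j
  simp [dsum_apply, size_zero]

theorem dsum_zero (x : MInf R) : dsum x 0 = x := by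
  ext i j
  rw [dsum_apply]
  split_ifs with h1 h2
  · rfl
  · exact (isSupp_size x i j (by omega)).symm
  · exact (isSupp_size x i j (by omega)).symm

theorem dsum_assoc (x y z : MInf R) : dsum (dsum x y) z = dsum x (dsum y z) := by
  ext i j
  simp only [dsum_apply, size_dsum]
  have e : ∀ i, i - x.size - y.size = i - (x.size + y.size) := fun i => by omega
  simp only [e]
  split_ifs <;> first | rfl | omega

end MInf

/-! ### The relation `≾₁` -/

/-- `x ≾₁ y` if `x = s y t` for some `s`, `t`. -/
def Sub1 {A : Type u} [NonUnitalRing A] (x y : A) : Prop := ∃ s t, x = s * y * t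

infix:50 " ≾₁ " => Sub1

/-- A ring is dense if the relation `≾₁` on `M_∞(R)` is dense. -/
def IsDenseRing (R : Type u) [NonUnitalRing R] : Prop :=
  ∀ x y : MInf R, x ≾₁ y → ∃ z, x ≾₁ z ∧ z ≾₁ y

/-- Left normal rings. -/
def IsLeftNormal (R : Type u) [NonUnitalRing R] : Prop :=
  ∀ a b c : MInf R, a = b * a → b = c * b → ∃ d e : MInf R, a = d * a ∧ d = e * d ∧ e = c * e

section Sub1

variable {A : Type u} [NonUnitalRing A]

theorem Sub1.trans {x y z : A} (h1 : x ≾₁ y) (h2 : y ≾₁ z) : x ≾₁ z := by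
  obtain ⟨s, t, rfl⟩ := h1
  obtain ⟨a, b, rfl⟩ := h2
  exact ⟨s * a, b * t, by simp only [mul_assoc]⟩

theorem Sub1.zero (y : A) : (0 : A) ≾₁ y := ⟨0, 0, by simp⟩

theorem Sub1.map {B : Type v} [NonUnitalRing B] (f : A →ₙ+* B) {x y : A} (h : x ≾₁ y) :
    f x ≾₁ f y := by
  obtain ⟨s, t, rfl⟩ := h
  exact ⟨f s, f t, by simp⟩

end Sub1

/-! ### Relabelling the indices of a matrix along partial injections -/

/-- A partial injection of the index set `ℕ` (with a growth bound, which makes the preimage of a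
finite set finite). -/
structure PInj where
  /-- The underlying partial map. -/
  toFun : ℕ → Option ℕ
  inj : ∀ i j a, toFun i = some a → toFun j = some a → i = j
  bound : ∃ c, ∀ i a, toFun i = some a → i ≤ 2 * a + c

namespace PInj

/-- The identity on `{i | i < n}`. -/
def lo (n : ℕ) : PInj where
  toFun i := if i < n then some i else none
  inj i j a := by split_ifs <;> (simp; try omega)
  bound := ⟨0, fun i a => by split_ifs <;> (simp; try omega)⟩

/-- The map `i ↦ i - n` on `{i | n ≤ i}`. -/
def hi (n : ℕ) : PInj where
  toFun i := if n ≤ i then some (i - n) else none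
  inj i j a := by split_ifs <;> (simp; try omega)
  bound := ⟨n, fun i a => by split_ifs <;> (simp; try omega)⟩

/-- The map `2 i ↦ i`. -/
def ev : PInj where
  toFun i := if i % 2 = 0 then some (i / 2) else none
  inj i j a := by split_ifs <;> (simp; try omega)
  bound := ⟨0, fun i a => by split_ifs <;> (simp; try omega)⟩

/-- The map `2 i + 1 ↦ i`. -/
def od : PInj where
  toFun i := if i % 2 = 1 then some (i / 2) else none
  inj i j a := by split_ifs <;> (simp; try omega)
  bound := ⟨1, fun i a => by split_ifs <;> (simp; try omega)⟩

/-- Partial injections with disjoint domains. -/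
def Disj (f g : PInj) : Prop := ∀ i, f.toFun i = none ∨ g.toFun i = none

theorem Disj.symm {f g : PInj} (h : Disj f g) : Disj g f := fun i => (h i).symm

theorem disj_lo_hi (n : ℕ) : Disj (lo n) (hi n) := by
  intro i
  simp only [lo, hi]
  split_ifs <;> first | omega | simp

theorem disj_ev_od : Disj ev od := by
  intro i
  simp only [ev, od]
  split_ifs <;> first | omega | simp

/-- All nonzero entries of `x` have indices in the range of `f`. -/
def Covers {R : Type u} [NonUnitalRing R] (f : PInj) (x : MInf R) : Prop :=
  ∀ i j, x i j ≠ 0 → (∃ k, f.toFun k = some i) ∧ ∃ k, f.toFun k = some j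

end PInj

namespace MInf

variable {R : Type u} [NonUnitalRing R]

/-- The matrix with entry `x (f i) (g j)` at `(i, j)` where `f i`, `g j` are defined, and zero
elsewhere. -/
def relabel (f g : PInj) (x : MInf R) : MInf R :=
  ⟨fun i j => (f.toFun i).elim 0 fun a => (g.toFun j).elim 0 fun b => x a b, by
    obtain ⟨n, hn⟩ := x.finite
    obtain ⟨c, hc⟩ := f.bound
    obtain ⟨d, hd⟩ := g.bound
    refine ⟨2 * n + c + d, fun i j h => ?_⟩
    dsimp only
    rcases hi : f.toFun i with _ | a
    · rfl
    rcases hj : g.toFun j with _ | b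
    · rfl
    have := hc i a hi
    have := hd j b hj
    exact hn a b (by omega)⟩

theorem relabel_apply (f g : PInj) (x : MInf R) (i j : ℕ) :
    relabel f g x i j = (f.toFun i).elim 0 fun a => (g.toFun j).elim 0 fun b => x a b := rfl

theorem relabel_mul_relabel (f g h : PInj) (s x : MInf R)
    (hx : ∀ i b j, s i b * x b j ≠ 0 → ∃ k, g.toFun k = some b) :
    relabel f g s * relabel g h x = relabel f h (s * x) := by
  ext i j
  obtain ⟨n, hn⟩ := (relabel f g s).finite
  obtain ⟨m, hm⟩ := s.finite
  rw [mul_apply_range hn, relabel_apply]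
  simp only [relabel_apply]
  rcases hfi : f.toFun i with _ | a
  · simp
  rcases h.toFun j with _ | c
  · simp only [Option.elim_some, Option.elim_none]
    refine Finset.sum_eq_zero fun k _ => ?_
    rcases g.toFun k with _ | b <;> simp
  simp only [Option.elim_some]
  rw [mul_apply_range hm]
  have key : ∀ k, (g.toFun k).elim 0 (fun b => s a b) * (g.toFun k).elim 0 (fun b => x b c) ≠ 0 →
      ∃ b, g.toFun k = some b := by
    intro k hk
    rcases hg : g.toFun k with _ | b
    · simp [hg] at hk
    · exact ⟨b, rfl⟩
  refine Finset.sum_bij_ne_zero (fun k _ _ => (g.toFun k).getD 0) ?_ ?_ ?_ ?_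
  · intro k _ hk
    obtain ⟨b, hb⟩ := key k hk
    simp only [hb, Option.elim_some, Option.getD_some, Finset.mem_range] at hk ⊢
    by_contra hlt
    exact hk (by rw [hm a b (by omega), zero_mul])
  · intro k _ hk k' _ hk' e
    obtain ⟨b, hb⟩ := key k hk
    obtain ⟨b', hb'⟩ := key k' hk'
    simp only [hb, hb', Option.getD_some] at e
    subst e
    exact g.inj k k' b hb hb'
  · intro b _ hb
    obtain ⟨k, hk⟩ := hx a b c hb
    have hne : (g.toFun k).elim 0 (fun b => s a b) * (g.toFun k).elim 0 (fun b => x b c) ≠ 0 := by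
      simpa [hk] using hb
    refine ⟨k, ?_, hne, by simp [hk]⟩
    rw [Finset.mem_range]
    by_contra hlt
    have h0 := hn i k (by omega)
    rw [relabel_apply, hfi, hk] at h0
    exact hb (by simp only [Option.elim_some] at h0; rw [h0, zero_mul])
  · intro k _ hk
    obtain ⟨b, hb⟩ := key k hk
    simp [hb]

theorem relabel_mul_relabel_of_disj (f g g' h : PInj) (hd : g.Disj g') (s x : MInf R) :
    relabel f g s * relabel g' h x = 0 := by
  ext i j
  rw [mul_apply, zero_apply]
  refine finsum_eq_zero_of_forall_eq_zero fun k => ?_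
  rw [relabel_apply, relabel_apply]
  rcases hd k with e | e
  · rw [e]
    rcases f.toFun i with _ | a <;> simp
  · rw [e]
    simp

/-- The sum of `x` and `y`, placed along two partial injections. -/
def psum (f g : PInj) (x y : MInf R) : MInf R := relabel f f x + relabel g g y

theorem psum_sub {f g f' g' : PInj} (_h : f.Disj g) (h' : f'.Disj g') {x y x' y' : MInf R}
    (hx : f'.Covers x') (hy : g'.Covers y') (hxx : x ≾₁ x') (hyy : y ≾₁ y') :
    psum f g x y ≾₁ psum f' g' x' y' := by
  obtain ⟨s, t, rfl⟩ := hxx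
  obtain ⟨a, b, rfl⟩ := hyy
  have cx : ∀ i k j, s i k * x' k j ≠ 0 → ∃ l, f'.toFun l = some k :=
    fun i k j h => (hx k j (right_ne_zero_of_mul h)).1
  have cy : ∀ i k j, a i k * y' k j ≠ 0 → ∃ l, g'.toFun l = some k :=
    fun i k j h => (hy k j (right_ne_zero_of_mul h)).1
  refine ⟨relabel f f' s + relabel g g' a, relabel f' f t + relabel g' g b, ?_⟩
  have e1 : (relabel f f' s + relabel g g' a) * psum f' g' x' y' =
      relabel f f' (s * x') + relabel g g' (a * y') := by
    rw [psum, add_mul, mul_add, mul_add, relabel_mul_relabel _ _ _ _ _ cx,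
      relabel_mul_relabel _ _ _ _ _ cy, relabel_mul_relabel_of_disj _ _ _ _ h',
      relabel_mul_relabel_of_disj _ _ _ _ h'.symm, add_zero, zero_add]
  rw [e1, add_mul, mul_add, mul_add, relabel_mul_relabel_of_disj _ _ _ _ h',
    relabel_mul_relabel_of_disj _ _ _ _ h'.symm, add_zero, zero_add, psum,
    relabel_mul_relabel, relabel_mul_relabel]
  · intro i l j hij
    have hij := left_ne_zero_of_mul hij
    rw [mul_apply] at hij
    obtain ⟨k, hk⟩ := not_forall.1 fun h => hij (finsum_eq_zero_of_forall_eq_zero h)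
    exact (hy k l (right_ne_zero_of_mul hk)).2
  · intro i l j hij
    have hij := left_ne_zero_of_mul hij
    rw [mul_apply] at hij
    obtain ⟨k, hk⟩ := not_forall.1 fun h => hij (finsum_eq_zero_of_forall_eq_zero h)
    exact (hx k l (right_ne_zero_of_mul hk)).2

theorem psum_mul {f g : PInj} (h : f.Disj g) {x y x' y' : MInf R} (hx : f.Covers x') (hy : g.Covers y') :
    psum f g x y * psum f g x' y' = psum f g (x * x') (y * y') := by
  rw [psum, psum, psum, add_mul, mul_add, mul_add, relabel_mul_relabel_of_disj _ _ _ _ h,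
    relabel_mul_relabel_of_disj _ _ _ _ h.symm, add_zero, zero_add,
    relabel_mul_relabel _ _ _ _ _ fun i k j h => (hx k j (right_ne_zero_of_mul h)).1,
    relabel_mul_relabel _ _ _ _ _ fun i k j h => (hy k j (right_ne_zero_of_mul h)).1]

theorem dsum_eq_psum (x y : MInf R) : dsum x y = psum (PInj.lo (size x)) (PInj.hi (size x)) x y := by
  ext i j
  simp only [dsum_apply, psum, add_apply, relabel_apply, PInj.lo, PInj.hi]
  split_ifs <;> first | omega | simp

theorem covers_lo (x : MInf R) : (PInj.lo (size x)).Covers x := by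
  intro i j h
  have hi : i < size x := by
    by_contra hlt
    exact h (isSupp_size x i j (by omega))
  have hj : j < size x := by
    by_contra hlt
    exact h (isSupp_size x i j (by omega))
  exact ⟨⟨i, by simp [PInj.lo, hi]⟩, ⟨j, by simp [PInj.lo, hj]⟩⟩

theorem covers_hi (n : ℕ) (x : MInf R) : (PInj.hi n).Covers x :=
  fun i j _ => ⟨⟨i + n, by simp [PInj.hi]⟩, ⟨j + n, by simp [PInj.hi]⟩⟩

theorem covers_ev (x : MInf R) : PInj.ev.Covers x :=
  fun i j _ => ⟨⟨2 * i, by simp [PInj.ev]⟩, ⟨2 * j, by simp [PInj.ev]⟩⟩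

theorem covers_od (x : MInf R) : PInj.od.Covers x :=
  fun i j _ => ⟨⟨2 * i + 1, by simp [PInj.od]; omega⟩, ⟨2 * j + 1, by simp [PInj.od]; omega⟩⟩

theorem dsum_sub {x y x' y' : MInf R} (hx : x ≾₁ x') (hy : y ≾₁ y') :
    dsum x y ≾₁ dsum x' y' := by
  rw [dsum_eq_psum, dsum_eq_psum]
  exact psum_sub (PInj.disj_lo_hi _) (PInj.disj_lo_hi _) (covers_lo _) (covers_hi _ _) hx hy

theorem dsum_sub_comm {x y x' y' : MInf R} (hx : x ≾₁ x') (hy : y ≾₁ y') :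
    dsum x y ≾₁ dsum y' x' := by
  rw [dsum_eq_psum, dsum_eq_psum, psum, add_comm]
  exact psum_sub (PInj.disj_lo_hi _).symm (PInj.disj_lo_hi _) (covers_lo _) (covers_hi _ _) hy hx

theorem map_dsum_sub {R' : Type v} [NonUnitalRing R'] (f : R →ₙ+* R') {x y x' y' : MInf R}
    (hx : x ≾₁ x') (hy : y ≾₁ y') :
    map f (dsum x y) ≾₁ dsum (map f x') (map f y') := by
  have e : map f (dsum x y) = psum (PInj.lo (size x)) (PInj.hi (size x)) (map f x) (map f y) := by
    ext i j
    simp only [map_apply, dsum_apply, psum, add_apply, relabel_apply, PInj.lo, PInj.hi]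
    split_ifs <;> first | omega | simp
  rw [e, dsum_eq_psum]
  exact psum_sub (PInj.disj_lo_hi _) (PInj.disj_lo_hi _) (covers_lo _) (covers_hi _ _)
    (hx.map _) (hy.map _)

theorem dsum_map_sub {R' : Type v} [NonUnitalRing R'] (f : R →ₙ+* R') {x y x' y' : MInf R}
    (hx : x ≾₁ x') (hy : y ≾₁ y') :
    dsum (map f x) (map f y) ≾₁ map f (dsum x' y') := by
  have e : map f (dsum x' y') =
      psum (PInj.lo (size x')) (PInj.hi (size x')) (map f x') (map f y') := by
    ext i j
    simp only [map_apply, dsum_apply, psum, add_apply, relabel_apply, PInj.lo, PInj.hi]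
    split_ifs <;> first | omega | simp
  rw [e, dsum_eq_psum]
  refine psum_sub (PInj.disj_lo_hi _) (PInj.disj_lo_hi _) (fun i j h => ?_) (covers_hi _ _)
    (hx.map _) (hy.map _)
  exact covers_lo x' i j fun h0 => h (by rw [map_apply, h0, map_zero])

end MInf

/-! ### The ordered monoid `Λ(R)` -/

/-- `T(R)`: the sequences in `M_∞(R)` with `x_n ≾₁ x_{n+1}` for all `n`. -/
structure IncSeq (R : Type u) [NonUnitalRing R] where
  /-- The terms of the sequence. -/
  seq : ℕ → MInf R
  step : ∀ n, seq n ≾₁ seq (n + 1)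

namespace IncSeq

variable {R : Type u} [NonUnitalRing R]

theorem lt (x : IncSeq R) {m n : ℕ} (h : m < n) : x.seq m ≾₁ x.seq n := by
  induction n, h using Nat.le_induction with
  | base => exact x.step m
  | succ k _ ih => exact ih.trans (x.step k)

/-- The relation `(x_n) ≾ (y_n)`: every `x_n` satisfies `x_n ≾₁ y_m` for some `m`. -/
instance : Preorder (IncSeq R) where
  le x y := ∀ n, ∃ m, x.seq n ≾₁ y.seq m
  le_refl x n := ⟨n + 1, x.step n⟩
  le_trans x y z hxy hyz n := by
    obtain ⟨m, hm⟩ := hxy n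
    obtain ⟨k, hk⟩ := hyz m
    exact ⟨k, hm.trans hk⟩

theorem le_def {x y : IncSeq R} : x ≤ y ↔ ∀ n, ∃ m, x.seq n ≾₁ y.seq m := Iff.rfl

theorem le_of_shift {x y : IncSeq R} (h : ∀ n, x.seq n ≾₁ y.seq (n + 1)) : x ≤ y :=
  fun n => ⟨n + 1, h n⟩

/-- Componentwise diagonal sum. -/
noncomputable def dsum (x y : IncSeq R) : IncSeq R :=
  ⟨fun n => MInf.dsum (x.seq n) (y.seq n), fun n => MInf.dsum_sub (x.step n) (y.step n)⟩

theorem dsum_le_dsum {x y x' y' : IncSeq R} (hx : x ≤ x') (hy : y ≤ y') :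
    dsum x y ≤ dsum x' y' := by
  intro n
  obtain ⟨a, ha⟩ := hx n
  obtain ⟨b, hb⟩ := hy n
  exact ⟨max a b + 1, MInf.dsum_sub (ha.trans (x'.lt (by omega))) (hb.trans (y'.lt (by omega)))⟩

/-- The constant sequence zero. -/
def zero : IncSeq R := ⟨fun _ => 0, fun _ => Sub1.zero 0⟩

/-- Entrywise image of a sequence under a ring homomorphism. -/
noncomputable def map {R' : Type v} [NonUnitalRing R'] (f : R →ₙ+* R') (x : IncSeq R) : IncSeq R' :=
  ⟨fun n => MInf.map f (x.seq n), fun n => (x.step n).map _⟩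

theorem map_le_map {R' : Type v} [NonUnitalRing R'] (f : R →ₙ+* R') {x y : IncSeq R} (h : x ≤ y) :
    map f x ≤ map f y := by
  intro n
  obtain ⟨m, hm⟩ := h n
  exact ⟨m, hm.map _⟩

/-- `𝒮(R)`: for every `n` there is `y_{n+1}` with `x_n = y_{n+1} x_{n+1} x_n`. -/
def IsS (x : IncSeq R) : Prop := ∀ n, ∃ y : MInf R, x.seq n = y * x.seq (n + 1) * x.seq n

end IncSeq

/-- `Λ(R)`: the sequences in `T(R)` modulo `(x_n) ≾ (y_n) ≾ (x_n)`, with the order induced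
by `≾`. -/
abbrev Lam (R : Type u) [NonUnitalRing R] : Type u := Antisymmetrization (IncSeq R) (· ≤ ·)

namespace Lam

variable {R : Type u} [NonUnitalRing R]

/-- The class of a sequence. -/
def mk (x : IncSeq R) : Lam R := toAntisymmetrization (· ≤ ·) x

theorem mk_le_mk {x y : IncSeq R} : mk x ≤ mk y ↔ x ≤ y := Iff.rfl

theorem mk_eq_mk {x y : IncSeq R} : mk x = mk y ↔ x ≤ y ∧ y ≤ x := by
  rw [← mk_le_mk, ← mk_le_mk, le_antisymm_iff]

theorem mk_surjective : Function.Surjective (mk : IncSeq R → Lam R) :=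
  fun a => Antisymmetrization.ind (· ≤ ·) (p := fun a => ∃ x, mk x = a) (fun x => ⟨x, rfl⟩) a

/-- Addition in `Λ(R)` is induced by the componentwise diagonal sum. -/
noncomputable instance : Add (Lam R) where
  add := Quotient.map₂ IncSeq.dsum fun _ _ hx _ _ hy =>
    ⟨IncSeq.dsum_le_dsum hx.1 hy.1, IncSeq.dsum_le_dsum hx.2 hy.2⟩

instance : Zero (Lam R) := ⟨mk IncSeq.zero⟩

theorem mk_add_mk (x y : IncSeq R) : mk x + mk y = mk (IncSeq.dsum x y) := rfl

theorem zero_def : (0 : Lam R) = mk IncSeq.zero := rfl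

noncomputable instance : AddCommMonoid (Lam R) where
  add_assoc a b c := by
    obtain ⟨x, rfl⟩ := mk_surjective a
    obtain ⟨y, rfl⟩ := mk_surjective b
    obtain ⟨z, rfl⟩ := mk_surjective c
    simp only [mk_add_mk, IncSeq.dsum, MInf.dsum_assoc]
  zero_add a := by
    obtain ⟨x, rfl⟩ := mk_surjective a
    simp only [zero_def, mk_add_mk, IncSeq.dsum, IncSeq.zero, MInf.zero_dsum]
  add_zero a := by
    obtain ⟨x, rfl⟩ := mk_surjective a
    simp only [zero_def, mk_add_mk, IncSeq.dsum, IncSeq.zero, MInf.dsum_zero]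
  add_comm a b := by
    obtain ⟨x, rfl⟩ := mk_surjective a
    obtain ⟨y, rfl⟩ := mk_surjective b
    rw [mk_add_mk, mk_add_mk, mk_eq_mk]
    exact ⟨IncSeq.le_of_shift fun n => MInf.dsum_sub_comm (x.step n) (y.step n),
      IncSeq.le_of_shift fun n => MInf.dsum_sub_comm (y.step n) (x.step n)⟩
  nsmul := nsmulRec

theorem zero_le (a : Lam R) : 0 ≤ a := by
  obtain ⟨x, rfl⟩ := mk_surjective a
  exact mk_le_mk.2 fun n => ⟨n, Sub1.zero _⟩

instance : IsOrderedAddMonoid (Lam R) where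
  add_le_add_left a b h c := by
    obtain ⟨x, rfl⟩ := mk_surjective a
    obtain ⟨y, rfl⟩ := mk_surjective b
    obtain ⟨z, rfl⟩ := mk_surjective c
    exact mk_le_mk.2 (IncSeq.dsum_le_dsum (mk_le_mk.1 h) le_rfl)

/-- `u` is `≾₁`-below some term of a sequence representing `a`. -/
def Below (u : MInf R) (a : Lam R) : Prop := ∃ x, mk x = a ∧ ∃ n, u ≾₁ x.seq n

theorem below_mk {u : MInf R} {x : IncSeq R} : Below u (mk x) ↔ ∃ n, u ≾₁ x.seq n := by
  constructor
  · rintro ⟨y, hy, n, hn⟩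
    obtain ⟨m, hm⟩ := (mk_eq_mk.1 hy).1 n
    exact ⟨m, hn.trans hm⟩
  · rintro ⟨n, hn⟩
    exact ⟨x, rfl, n, hn⟩

theorem below_seq (x : IncSeq R) (n : ℕ) : Below (x.seq n) (mk x) := below_mk.2 ⟨n + 1, x.step n⟩

theorem Below.of_sub {u v : MInf R} {a : Lam R} (h : Below v a) (huv : u ≾₁ v) : Below u a := by
  obtain ⟨x, hx, n, hn⟩ := h
  exact ⟨x, hx, n, huv.trans hn⟩

theorem Below.of_le {u : MInf R} {a b : Lam R} (h : Below u a) (hab : a ≤ b) : Below u b := by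
  obtain ⟨x, rfl⟩ := mk_surjective a
  obtain ⟨y, rfl⟩ := mk_surjective b
  obtain ⟨n, hn⟩ := below_mk.1 h
  obtain ⟨m, hm⟩ := mk_le_mk.1 hab n
  exact below_mk.2 ⟨m, hn.trans hm⟩

theorem le_iff_below {a b : Lam R} : a ≤ b ↔ ∀ u, Below u a → Below u b := by
  refine ⟨fun h u hu => hu.of_le h, fun h => ?_⟩
  obtain ⟨x, rfl⟩ := mk_surjective a
  obtain ⟨y, rfl⟩ := mk_surjective b
  exact mk_le_mk.2 fun n => below_mk.1 (h _ (below_seq x n))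

theorem mk_le_iff {x : IncSeq R} {b : Lam R} : mk x ≤ b ↔ ∀ n, Below (x.seq n) b := by
  refine ⟨fun h n => (below_seq x n).of_le h, fun h => le_iff_below.2 fun u hu => ?_⟩
  obtain ⟨n, hn⟩ := below_mk.1 hu
  exact (h n).of_sub hn

theorem Below.directed {u v : MInf R} {a : Lam R} (hu : Below u a) (hv : Below v a) :
    ∃ w, Below w a ∧ u ≾₁ w ∧ v ≾₁ w := by
  obtain ⟨x, rfl⟩ := mk_surjective a
  obtain ⟨n, hn⟩ := below_mk.1 hu
  obtain ⟨m, hm⟩ := below_mk.1 hv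
  exact ⟨x.seq (max n m + 1), below_seq x _, hn.trans (x.lt (by omega)), hm.trans (x.lt (by omega))⟩

/-- Every increasing sequence in `Λ(R)` has a supremum; the elements below it are those below
some member of the sequence. -/
theorem exists_sup (a : ℕ → Lam R) (ha : Monotone a) :
    ∃ s : Lam R, ∀ u, Below u s ↔ ∃ i, Below u (a i) := by
  choose X hX using fun i => mk_surjective (a i)
  let J : MInf R → Prop := fun u => ∃ i, Below u (a i)
  have hJ : ∀ u v, J u → J v → ∃ w, J w ∧ u ≾₁ w ∧ v ≾₁ w := by
    rintro u v ⟨i, hi⟩ ⟨j, hj⟩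
    obtain ⟨w, hw, h1, h2⟩ :=
      (hi.of_le (ha (le_max_left i j))).directed (hj.of_le (ha (le_max_right i j)))
    exact ⟨w, ⟨_, hw⟩, h1, h2⟩
  let c : ℕ → MInf R := fun k => (X k.unpair.1).seq k.unpair.2
  have hc : ∀ k, J (c k) := fun k => ⟨k.unpair.1, by rw [← hX]; exact below_seq _ _⟩
  have step : ∀ (u : {u // J u}) (k : ℕ), ∃ w : {u // J u}, u.1 ≾₁ w.1 ∧ c k ≾₁ w.1 := by
    intro u k
    obtain ⟨w, hw, h1, h2⟩ := hJ u.1 (c k) u.2 (hc k)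
    exact ⟨⟨w, hw⟩, h1, h2⟩
  choose nxt h1 h2 using step
  let w : ℕ → {u // J u} := fun n => Nat.rec ⟨c 0, hc 0⟩ (fun k u => nxt u k) n
  refine ⟨mk ⟨fun n => (w n).1, fun n => h1 (w n) n⟩, fun u => ?_⟩
  rw [below_mk]
  constructor
  · rintro ⟨n, hn⟩
    obtain ⟨i, hi⟩ := (w n).2
    exact ⟨i, hi.of_sub hn⟩
  · rintro ⟨i, hi⟩
    rw [← hX, below_mk] at hi
    obtain ⟨n, hn⟩ := hi
    refine ⟨Nat.pair i n + 1, hn.trans ?_⟩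
    have := h2 (w (Nat.pair i n)) (Nat.pair i n)
    simpa only [c, Nat.unpair_pair] using this

theorem isLUB_of_below {a : ℕ → Lam R} {s : Lam R} (h : ∀ u, Below u s ↔ ∃ i, Below u (a i)) :
    IsLUB (Set.range a) s := by
  constructor
  · rintro _ ⟨i, rfl⟩
    exact le_iff_below.2 fun u hu => (h u).2 ⟨i, hu⟩
  · intro t ht
    refine le_iff_below.2 fun u hu => ?_
    obtain ⟨i, hi⟩ := (h u).1 hu
    exact hi.of_le (ht ⟨i, rfl⟩)

theorem below_isLUB {a : ℕ → Lam R} (ha : Monotone a) {s : Lam R} (hs : IsLUB (Set.range a) s)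
    (u : MInf R) : Below u s ↔ ∃ i, Below u (a i) := by
  obtain ⟨t, ht⟩ := exists_sup a ha
  rw [hs.unique (isLUB_of_below ht), ht]

theorem below_add {u : MInf R} {x y : IncSeq R} :
    Below u (mk x + mk y) ↔ ∃ n, u ≾₁ MInf.dsum (x.seq n) (y.seq n) := below_mk

theorem below_dsum {u v : MInf R} {a b : Lam R} (hu : Below u a) (hv : Below v b) :
    Below (MInf.dsum u v) (a + b) := by
  obtain ⟨x, rfl⟩ := mk_surjective a
  obtain ⟨y, rfl⟩ := mk_surjective b
  obtain ⟨n, hn⟩ := below_mk.1 hu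
  obtain ⟨m, hm⟩ := below_mk.1 hv
  exact below_add.2 ⟨max n m + 1, MInf.dsum_sub (hn.trans (x.lt (by omega)))
    (hm.trans (y.lt (by omega)))⟩

/-- Suprema of increasing sequences are compatible with addition. -/
theorem isLUB_add {a b : ℕ → Lam R} (ha : Monotone a) (hb : Monotone b) {s t : Lam R}
    (hs : IsLUB (Set.range a) s) (ht : IsLUB (Set.range b) t) :
    IsLUB (Set.range fun n => a n + b n) (s + t) := by
  constructor
  · rintro _ ⟨i, rfl⟩
    exact add_le_add (hs.1 ⟨i, rfl⟩) (ht.1 ⟨i, rfl⟩)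
  · intro r hr
    obtain ⟨x, rfl⟩ := mk_surjective s
    obtain ⟨y, rfl⟩ := mk_surjective t
    rw [mk_add_mk, mk_le_iff]
    intro n
    obtain ⟨i, hi⟩ := (below_isLUB ha hs _).1 (below_seq x n)
    obtain ⟨j, hj⟩ := (below_isLUB hb ht _).1 (below_seq y n)
    exact (below_dsum (hi.of_le (ha (le_max_left i j))) (hj.of_le (hb (le_max_right i j)))).of_le
      (hr ⟨max i j, rfl⟩)

/-- The map `Λ(R) → Λ(R')` induced by a ring homomorphism `R → R'`. -/
noncomputable def map {R' : Type v} [NonUnitalRing R'] (f : R →ₙ+* R') : Lam R →+ Lam R' where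
  toFun := Quotient.map (IncSeq.map f) fun _ _ h => ⟨IncSeq.map_le_map f h.1, IncSeq.map_le_map f h.2⟩
  map_zero' := by
    change mk (IncSeq.map f IncSeq.zero) = mk IncSeq.zero
    congr 1
    simp [IncSeq.map, IncSeq.zero]
  map_add' a b := by
    obtain ⟨x, rfl⟩ := mk_surjective a
    obtain ⟨y, rfl⟩ := mk_surjective b
    change mk (IncSeq.map f (IncSeq.dsum x y)) = mk (IncSeq.dsum (IncSeq.map f x) (IncSeq.map f y))
    rw [mk_eq_mk]
    exact ⟨IncSeq.le_of_shift fun n => MInf.map_dsum_sub f (x.step n) (y.step n),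
      IncSeq.le_of_shift fun n => MInf.dsum_map_sub f (x.step n) (y.step n)⟩

theorem map_mk {R' : Type v} [NonUnitalRing R'] (f : R →ₙ+* R') (x : IncSeq R) :
    map f (mk x) = mk (IncSeq.map f x) := rfl

theorem map_mono {R' : Type v} [NonUnitalRing R'] (f : R →ₙ+* R') : Monotone (map f) := by
  intro a b h
  obtain ⟨x, rfl⟩ := mk_surjective a
  obtain ⟨y, rfl⟩ := mk_surjective b
  exact mk_le_mk.2 (IncSeq.map_le_map f (mk_le_mk.1 h))

theorem Below.map {R' : Type v} [NonUnitalRing R'] (f : R →ₙ+* R') {u : MInf R} {a : Lam R}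
    (h : Below u a) : Below (MInf.map f u) (Lam.map f a) := by
  obtain ⟨x, rfl, n, hn⟩ := h
  exact below_mk.2 ⟨n, hn.map _⟩

theorem isLUB_map {R' : Type v} [NonUnitalRing R'] (f : R →ₙ+* R') {a : ℕ → Lam R}
    (ha : Monotone a) {s : Lam R} (hs : IsLUB (Set.range a) s) :
    IsLUB (Set.range fun n => map f (a n)) (map f s) := by
  constructor
  · rintro _ ⟨i, rfl⟩
    exact map_mono f (hs.1 ⟨i, rfl⟩)
  · intro t ht
    obtain ⟨x, rfl⟩ := mk_surjective s
    rw [map_mk, mk_le_iff]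
    intro n
    obtain ⟨i, hi⟩ := (below_isLUB ha hs _).1 (below_seq x n)
    exact (hi.map f).of_le (ht ⟨i, rfl⟩)

end Lam

/-! ### The category `SCu` -/

/-- The way-below (compact containment) relation `≪`. -/
def WayBelow {S : Type u} [PartialOrder S] (x y : S) : Prop :=
  ∀ z : ℕ → S, Monotone z → ∀ s, IsLUB (Set.range z) s → y ≤ s → ∃ m, x ≤ z m

/-- Abstract `Cu`-semigroups: positively ordered monoids satisfying (O1)-(O4). -/
class CuSemigroup (S : Type u) [AddCommMonoid S] [PartialOrder S] : Prop
    extends IsOrderedAddMonoid S where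
  zero_le : ∀ x : S, 0 ≤ x
  /-- (O1) Increasing sequences have suprema. -/
  exists_isLUB : ∀ x : ℕ → S, Monotone x → ∃ s, IsLUB (Set.range x) s
  /-- (O2) Every element is the supremum of a rapidly increasing sequence. -/
  exists_rapid : ∀ x : S, ∃ z : ℕ → S, (∀ n, WayBelow (z n) (z (n + 1))) ∧ IsLUB (Set.range z) x
  /-- (O3) Addition preserves the way-below relation. -/
  wayBelow_add : ∀ x' x y' y : S, WayBelow x' x → WayBelow y' y → WayBelow (x' + y') (x + y)
  /-- (O4) Addition is compatible with suprema of increasing sequences. -/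
  isLUB_add : ∀ x y : ℕ → S, Monotone x → Monotone y → ∀ s t, IsLUB (Set.range x) s →
    IsLUB (Set.range y) t → IsLUB (Set.range fun n => x n + y n) (s + t)

/-- A sequence `x` is weakly increasing if there is an increasing sequence `y` such that every
`y m` is eventually below `x n`, and every `x n` is below the supremum of `y`. -/
def WeaklyIncreasing {S : Type u} [PartialOrder S] (x : ℕ → S) : Prop :=
  ∃ y : ℕ → S, Monotone y ∧ (∀ m, ∃ N, ∀ n, N ≤ n → y m ≤ x n) ∧
    ∃ s, IsLUB (Set.range y) s ∧ ∀ n, x n ≤ s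

/-- The objects of the category `SCu`: pairs `(S, W)` with `S` a `Cu`-semigroup and `W` a
submonoid closed under suprema of weakly increasing sequences. -/
structure SCu : Type (u + 1) where
  /-- The ambient semigroup `S`. -/
  S : Type u
  [addCommMonoid : AddCommMonoid S]
  [partialOrder : PartialOrder S]
  [cu : CuSemigroup S]
  /-- The submonoid `W`. -/
  W : AddSubmonoid S
  sup_mem : ∀ x : ℕ → S, (∀ n, x n ∈ W) → WeaklyIncreasing x →
    ∀ s, IsLUB (Set.range x) s → s ∈ W

attribute [instance] SCu.addCommMonoid SCu.partialOrder SCu.cu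

/-- The morphisms `(S₁, W₁) → (S₂, W₂)` of `SCu`: the `Cu`-morphisms `f : S₁ → S₂` with
`f(W₁) ⊆ W₂`. -/
@[ext] structure SCu.Hom (A B : SCu.{u}) where
  /-- The underlying monoid homomorphism. -/
  toAddHom : A.S →+ B.S
  monotone : Monotone toAddHom
  wayBelow : ∀ x y, WayBelow x y → WayBelow (toAddHom x) (toAddHom y)
  isLUB : ∀ x : ℕ → A.S, Monotone x → ∀ s, IsLUB (Set.range x) s →
    IsLUB (Set.range fun n => toAddHom (x n)) (toAddHom s)
  mem : ∀ x ∈ A.W, toAddHom x ∈ B.W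

instance : Category SCu.{u} where
  Hom := SCu.Hom
  id A :=
    { toAddHom := AddMonoidHom.id A.S
      monotone := monotone_id
      wayBelow := fun _ _ h => h
      isLUB := fun _ _ _ h => h
      mem := fun _ h => h }
  comp f g :=
    { toAddHom := g.toAddHom.comp f.toAddHom
      monotone := g.monotone.comp f.monotone
      wayBelow := fun x y h => g.wayBelow _ _ (f.wayBelow x y h)
      isLUB := fun x hx s h => g.isLUB _ (f.monotone.comp hx) _ (f.isLUB x hx s h)
      mem := fun x h => g.mem _ (f.mem x h) }

/-! ### `Λ(R)` is a `Cu`-semigroup for a dense ring `R` -/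

namespace Lam

variable {R : Type u} [NonUnitalRing R]

theorem wayBelow_of_sub {a b : Lam R} {u : MInf R} (hb : Below u b)
    (ha : ∀ v, Below v a → v ≾₁ u) : WayBelow a b := by
  intro z hz s hs hle
  obtain ⟨i, hi⟩ := (below_isLUB hz hs u).1 (hb.of_le hle)
  exact ⟨i, le_iff_below.2 fun v hv => hi.of_sub (ha v hv)⟩

theorem exists_between (hR : IsDenseRing R) {u v : MInf R} (h : u ≾₁ v) :
    ∃ z : IncSeq R, Below u (mk z) ∧ ∀ w, Below w (mk z) → w ≾₁ v := by
  have step : ∀ w : {w : MInf R // w ≾₁ v}, ∃ w' : {w : MInf R // w ≾₁ v}, w.1 ≾₁ w'.1 := by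
    rintro ⟨w, hw⟩
    obtain ⟨z, h1, h2⟩ := hR w v hw
    exact ⟨⟨z, h2⟩, h1⟩
  choose nxt hn using step
  let z : ℕ → {w : MInf R // w ≾₁ v} := fun n => Nat.rec ⟨u, h⟩ (fun _ w => nxt w) n
  refine ⟨⟨fun n => (z n).1, fun n => hn (z n)⟩, below_mk.2 ⟨1, hn (z 0)⟩, fun w hw => ?_⟩
  obtain ⟨n, hn⟩ := below_mk.1 hw
  exact hn.trans (z n).2

theorem exists_rapid (hR : IsDenseRing R) (x : IncSeq R) :
    ∃ z : ℕ → Lam R, Monotone z ∧ IsLUB (Set.range z) (mk x) ∧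
      (∀ n w, Below w (z n) → w ≾₁ x.seq (n + 1)) ∧ ∀ n, Below (x.seq n) (z n) := by
  choose z h1 h2 using fun n => exists_between hR (x.step n)
  have hmono : Monotone fun n => mk (z n) := monotone_nat_of_le_succ fun n =>
    le_iff_below.2 fun u hu => (h1 (n + 1)).of_sub (h2 n u hu)
  refine ⟨fun n => mk (z n), hmono, isLUB_of_below fun u => ?_, h2, h1⟩
  rw [below_mk]
  constructor
  · rintro ⟨n, hn⟩
    exact ⟨n, (h1 n).of_sub hn⟩
  · rintro ⟨n, hn⟩
    exact ⟨n + 1, h2 n u hn⟩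

theorem wayBelow_iff (hR : IsDenseRing R) {a b : Lam R} :
    WayBelow a b ↔ ∃ u, Below u b ∧ ∀ v, Below v a → v ≾₁ u := by
  refine ⟨fun h => ?_, fun ⟨u, hu, h⟩ => wayBelow_of_sub hu h⟩
  obtain ⟨x, rfl⟩ := mk_surjective b
  obtain ⟨z, hz, hs, h1, -⟩ := exists_rapid hR x
  obtain ⟨m, hm⟩ := h z hz _ hs le_rfl
  exact ⟨x.seq (m + 1), below_seq x _, fun v hv => h1 m v (hv.of_le hm)⟩

theorem cuSemigroup (hR : IsDenseRing R) : CuSemigroup (Lam R) where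
  zero_le := zero_le
  exists_isLUB a ha := by
    obtain ⟨s, hs⟩ := exists_sup a ha
    exact ⟨s, isLUB_of_below hs⟩
  exists_rapid a := by
    obtain ⟨x, rfl⟩ := mk_surjective a
    obtain ⟨z, -, hs, h1, h2⟩ := exists_rapid hR x
    exact ⟨z, fun n => wayBelow_of_sub (h2 (n + 1)) (h1 n), hs⟩
  wayBelow_add a' a b' b ha hb := by
    obtain ⟨u, hu, h1⟩ := (wayBelow_iff hR).1 ha
    obtain ⟨v, hv, h2⟩ := (wayBelow_iff hR).1 hb
    refine (wayBelow_iff hR).2 ⟨MInf.dsum u v, below_dsum hu hv, fun w hw => ?_⟩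
    obtain ⟨x, rfl⟩ := mk_surjective a'
    obtain ⟨y, rfl⟩ := mk_surjective b'
    obtain ⟨n, hn⟩ := below_add.1 hw
    exact hn.trans (MInf.dsum_sub (h1 _ (below_seq x n)) (h2 _ (below_seq y n)))
  isLUB_add _ _ hx hy _ _ hs ht := isLUB_add hx hy hs ht

theorem wayBelow_map (hR : IsDenseRing R) {R' : Type v} [NonUnitalRing R'] (f : R →ₙ+* R')
    {a b : Lam R} (h : WayBelow a b) : WayBelow (map f a) (map f b) := by
  obtain ⟨u, hu, h1⟩ := (wayBelow_iff hR).1 h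
  refine wayBelow_of_sub (hu.map f) fun v hv => ?_
  obtain ⟨x, rfl⟩ := mk_surjective a
  rw [map_mk, below_mk] at hv
  obtain ⟨n, hn⟩ := hv
  exact hn.trans ((h1 _ (below_seq x n)).map _)

end Lam

/-! ### The submonoid `S(R)` of `Λ(R)` -/

/-- `S(R)`, viewed as a subset of `Λ(R)`: the classes of the sequences in `𝒮(R)`. -/
def subS (R : Type u) [NonUnitalRing R] : AddSubmonoid (Lam R) where
  carrier := {a | ∃ x : IncSeq R, x.IsS ∧ Lam.mk x = a}
  zero_mem' := ⟨IncSeq.zero, fun _ => ⟨0, by simp [IncSeq.zero]⟩, rfl⟩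
  add_mem' := by
    rintro _ _ ⟨x, hx, rfl⟩ ⟨y, hy, rfl⟩
    have hd := PInj.disj_ev_od
    refine ⟨⟨fun n => MInf.psum PInj.ev PInj.od (x.seq n) (y.seq n), fun n =>
      MInf.psum_sub hd hd (MInf.covers_ev _) (MInf.covers_od _) (x.step n) (y.step n)⟩,
      fun n => ?_, ?_⟩
    · obtain ⟨a, ha⟩ := hx n
      obtain ⟨b, hb⟩ := hy n
      refine ⟨MInf.psum PInj.ev PInj.od a b, ?_⟩
      dsimp only
      rw [MInf.psum_mul hd (MInf.covers_ev _) (MInf.covers_od _),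
        MInf.psum_mul hd (MInf.covers_ev _) (MInf.covers_od _), ← ha, ← hb]
    · rw [Lam.mk_add_mk, Lam.mk_eq_mk]
      constructor
      · refine IncSeq.le_of_shift fun n => ?_
        simp only [IncSeq.dsum, MInf.dsum_eq_psum]
        exact MInf.psum_sub hd (PInj.disj_lo_hi _) (MInf.covers_lo _) (MInf.covers_hi _ _)
          (x.step n) (y.step n)
      · refine IncSeq.le_of_shift fun n => ?_
        simp only [IncSeq.dsum, MInf.dsum_eq_psum]
        exact MInf.psum_sub (PInj.disj_lo_hi _) hd (MInf.covers_ev _) (MInf.covers_od _)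
          (x.step n) (y.step n)

theorem map_mem_subS {R : Type u} [NonUnitalRing R] {R' : Type v} [NonUnitalRing R']
    (f : R →ₙ+* R') {a : Lam R} (h : a ∈ subS R) : Lam.map f a ∈ subS R' := by
  obtain ⟨x, hx, rfl⟩ := h
  refine ⟨IncSeq.map f x, fun n => ?_, rfl⟩
  obtain ⟨y, hy⟩ := hx n
  refine ⟨MInf.map f y, ?_⟩
  simp only [IncSeq.map]
  rw [← map_mul, ← map_mul, ← hy]

/-- `S(R)` is closed under suprema of weakly increasing sequences. -/
theorem sup_mem_subS {R : Type u} [NonUnitalRing R] (a : ℕ → Lam R) (ha : ∀ n, a n ∈ subS R)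
    (hw : WeaklyIncreasing a) (s : Lam R) (hs : IsLUB (Set.range a) s) : s ∈ subS R := by
  obtain ⟨b, hb, hba, t, ht, hat⟩ := hw
  have hst : s = t := by
    apply le_antisymm
    · refine hs.2 ?_
      rintro _ ⟨n, rfl⟩
      exact hat n
    · refine ht.2 ?_
      rintro _ ⟨m, rfl⟩
      obtain ⟨N, hN⟩ := hba m
      exact (hN N le_rfl).trans (hs.1 ⟨N, rfl⟩)
  subst hst
  choose X hX hXa using ha
  choose Y hY using hX
  obtain ⟨z, rfl⟩ := Lam.mk_surjective s
  have habove : ∀ p : ℕ × ℕ, Lam.Below ((X p.1).seq p.2) (Lam.mk z) := fun p =>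
    (Lam.below_seq (X p.1) p.2).of_le (by rw [hXa]; exact hat _)
  have step : ∀ (p : ℕ × ℕ) (m : ℕ), ∃ q : ℕ × ℕ,
      (X p.1).seq (p.2 + 1) ≾₁ (X q.1).seq q.2 ∧ z.seq m ≾₁ (X q.1).seq q.2 := by
    intro p m
    obtain ⟨w, hw, h1, h2⟩ := (habove (p.1, p.2 + 1)).directed (Lam.below_seq z m)
    obtain ⟨i, hi⟩ := (Lam.below_isLUB hb ht w).1 hw
    obtain ⟨N, hN⟩ := hba i
    have hwN := hi.of_le (hN N le_rfl)
    rw [← hXa, Lam.below_mk] at hwN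
    obtain ⟨l, hl⟩ := hwN
    exact ⟨(N, l), h1.trans hl, h2.trans hl⟩
  choose nxt h1 h2 using step
  let p : ℕ → ℕ × ℕ := fun n => Nat.rec (0, 0) (fun m q => nxt q m) n
  let P : ℕ → MInf R := fun m => (X (p m).1).seq (p m).2
  let Q : ℕ → MInf R := fun m => (X (p m).1).seq ((p m).2 + 1)
  let y : ℕ → MInf R := fun m => Y (p m).1 (p m).2
  have hP : ∀ m, P m = y m * Q m * P m := fun m => hY (p m).1 (p m).2
  have hQ : ∀ m, Q m ≾₁ P (m + 1) := fun m => h1 (p m) m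
  have hz : ∀ m, z.seq m ≾₁ P (m + 1) := fun m => h2 (p m) m
  choose c d hcd using hQ
  have hw : ∀ m, P (m + 1) * d m =
      y (m + 1) * c (m + 1) * (P (m + 2) * d (m + 1)) * (P (m + 1) * d m) := by
    intro m
    conv_lhs => rw [hP (m + 1), hcd (m + 1)]
    simp only [mul_assoc]
  refine ⟨⟨fun m => P (m + 1) * d m, fun m => ⟨_, _, hw m⟩⟩, fun m => ⟨_, hw m⟩, ?_⟩
  apply le_antisymm
  · refine Lam.mk_le_iff.2 fun m => (habove ((p (m + 1)).1, (p (m + 1)).2 + 1)).of_sub ?_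
    refine ⟨y (m + 1), P (m + 1) * d m, ?_⟩
    change P (m + 1) * d m = y (m + 1) * Q (m + 1) * (P (m + 1) * d m)
    conv_lhs => rw [hP (m + 1)]
    simp only [mul_assoc]
  · refine Lam.mk_le_mk.2 fun m => ⟨m + 1, (hz m).trans ⟨y (m + 1) * c (m + 1), P (m + 1), ?_⟩⟩
    change P (m + 1) = y (m + 1) * c (m + 1) * (P (m + 2) * d (m + 1)) * P (m + 1)
    conv_lhs => rw [hP (m + 1), hcd (m + 1)]
    simp only [mul_assoc]

/-! ### Categories of rings and the functor `SCu` -/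

/-- The category of (not necessarily unital) rings and ring homomorphisms. -/
structure Rings : Type (u + 1) where
  /-- The underlying type. -/
  carrier : Type u
  [nonUnitalRing : NonUnitalRing carrier]

attribute [instance] Rings.nonUnitalRing

instance : CoeSort Rings.{u} (Type u) := ⟨Rings.carrier⟩

instance : Category Rings.{u} where
  Hom A B := A.carrier →ₙ+* B.carrier
  id A := NonUnitalRingHom.id A.carrier
  comp f g := NonUnitalRingHom.comp g f

/-- The property of being a dense ring. -/
def denseProp : ObjectProperty Rings.{u} := fun R => IsDenseRing R

/-- The full subcategory of dense rings. -/
abbrev DenseRings : Type (u + 1) := denseProp.{u}.FullSubcategory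

/-- The functor `SCu` from dense rings to the category `SCu`, `R ↦ (Λ(R), S(R))`. -/
noncomputable def SCuFunctor : DenseRings.{u} ⥤ SCu.{u} where
  obj R :=
    { S := Lam R.obj
      cu := Lam.cuSemigroup R.property
      W := subS R.obj
      sup_mem := sup_mem_subS }
  map {R _} f :=
    { toAddHom := Lam.map f.hom
      monotone := Lam.map_mono f.hom
      wayBelow := fun _ _ h => Lam.wayBelow_map R.property f.hom h
      isLUB := fun _ hx _ hs => Lam.isLUB_map f.hom hx hs
      mem := fun _ h => map_mem_subS f.hom h }
  map_id R := by
    apply SCu.Hom.ext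
    ext a
    obtain ⟨x, rfl⟩ := Lam.mk_surjective a
    rfl
  map_comp f g := by
    apply SCu.Hom.ext
    ext a
    obtain ⟨x, rfl⟩ := Lam.mk_surjective a
    rfl

/-- A cocone in the category of rings under a diagram of dense rings, seen as a cocone in the
category of dense rings when its apex is dense. -/
def denseCocone {J : Type v} [Category.{v} J] {F : J ⥤ DenseRings.{u}}
    (c : Cocone (F ⋙ denseProp.ι)) (h : IsDenseRing c.pt) : Cocone F where
  pt := ⟨c.pt, h⟩
  ι :=
    { app := fun j => ObjectProperty.homMk (c.ι.app j)
      naturality := fun i j f => by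
        apply ObjectProperty.hom_ext
        exact c.ι.naturality f }

end CuntzRing

-- An element of `Λ(R)` is determined by the matrices `Below` it, and for dense `R` one has `a ≪ b`
-- exactly when a single matrix below `b` dominates, under `≾₁`, everything below `a`. The theorem
-- holds because such finitary data already live at a finite stage of the system.
--
-- A finitely supported matrix has finitely many entries, so `M_∞` commutes with direct limits
-- (`IsDirectLimit.mInf`), and a relation `x ≾₁ y` over `R` comes from some `R_λ`. This gives
-- density of `R`. It also lets each step of a sequence in `T(R)` be lifted to a stage and, by
-- density there, interpolated by an element of some `Λ(R_λ)`. Hence every `a` in `Λ(R)` is the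
-- supremum of images of elements `a_n` of the `Λ(R_λ)`, sandwiched between matrices over `R`
-- (`Chain`). The stages need not increase; what matters is that `a_n ≪ a_{n+1}` after passing to a
-- common later stage (`exists_wayBelow`). For this the domination must be witnessed at a stage and
-- not merely over `R`, which is what `Bounds` records.
--
-- Given a cocone with apex `(S, W)`, its value at `a` has to be the supremum of its values on the
-- `a_n`. To avoid choices it is defined as the supremum over all elements bounded by some matrix
-- below `a`. Every chain is cofinal in that set, so the supremum exists. The canonical set makes
-- monotonicity and continuity easy to see; chains give additivity, preservation of `≪` and
-- uniqueness.
--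
-- The submonoids need left normality. A sequence in `𝒮(R)` satisfies infinitely many equations, and
-- only finitely many of them lift to one stage. Two equations `a = b a`, `b = c b` suffice: in a
-- left normal ring they generate an entire sequence in `𝒮(R_λ)` between `a` and `c`
-- (`IsLeftNormal.exists_mem_subS`). Thus elements of `S(R)` have chains inside the `S(R_λ)`, and
-- closure of `W` under suprema concludes.

universe w w' z

namespace CuntzRing

/-! ### Direct limits of rings, elementwise -/

/-- The elementwise description of a direct limit of rings over a directed set. -/
structure IsDirectLimit {Ω : Type v} [Preorder Ω] {A : Ω → Type w} [∀ l, NonUnitalRing (A l)]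
    (φ : ∀ l m, l ≤ m → A l →ₙ+* A m) {R : Type w'} [NonUnitalRing R]
    (ψ : ∀ l, A l →ₙ+* R) : Prop where
  map_map : ∀ l m k (h : l ≤ m) (h' : m ≤ k) (a : A l),
    φ m k h' (φ l m h a) = φ l k (h.trans h') a
  map_limit : ∀ l m (h : l ≤ m) (a : A l), ψ m (φ l m h a) = ψ l a
  surj : ∀ r, ∃ l, ∃ a : A l, ψ l a = r
  inj : ∀ l (a b : A l), ψ l a = ψ l b → ∃ m, ∃ h : l ≤ m, φ l m h a = φ l m h b

namespace IsDirectLimit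

variable {Ω : Type v} [Preorder Ω] {A : Ω → Type w} [∀ l, NonUnitalRing (A l)]
  {φ : ∀ l m, l ≤ m → A l →ₙ+* A m} {R : Type w'} [NonUnitalRing R] {ψ : ∀ l, A l →ₙ+* R}

/-- Two equations in a direct limit hold at a common stage. -/
theorem exists_eq_eq (D : IsDirectLimit φ ψ) {l : Ω} {a b a' b' : A l} (h : ψ l a = ψ l b)
    (h' : ψ l a' = ψ l b') :
    ∃ m, ∃ hm : l ≤ m, φ l m hm a = φ l m hm b ∧ φ l m hm a' = φ l m hm b' := by
  obtain ⟨m, hm, e⟩ := D.inj l a b h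
  obtain ⟨k, hk, e'⟩ := D.inj m (φ l m hm a') (φ l m hm b')
    (by rw [D.map_limit, D.map_limit, h'])
  exact ⟨k, hm.trans hk, by rw [← D.map_map _ _ _ hm hk, e, D.map_map],
    by rw [← D.map_map _ _ _ hm hk, e', D.map_map]⟩

/-- Finitely many equations in a direct limit hold at a common stage. -/
theorem exists_eq_fin (D : IsDirectLimit φ ψ) {l : Ω} {a b : ℕ → A l} (n : ℕ)
    (h : ∀ i, i < n → ψ l (a i) = ψ l (b i)) :
    ∃ m, ∃ hm : l ≤ m, ∀ i, i < n → φ l m hm (a i) = φ l m hm (b i) := by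
  induction n with
  | zero => exact ⟨l, le_rfl, fun i h => absurd h (Nat.not_lt_zero i)⟩
  | succ n ih =>
    obtain ⟨m, hm, e⟩ := ih fun i hi => h i (by omega)
    obtain ⟨k, hk, e'⟩ := D.inj m (φ l m hm (a n)) (φ l m hm (b n))
      (by rw [D.map_limit, D.map_limit, h n (by omega)])
    refine ⟨k, hm.trans hk, fun i hi => ?_⟩
    rw [← D.map_map _ _ _ hm hk, ← D.map_map _ _ _ hm hk]
    rcases Nat.lt_succ_iff_lt_or_eq.1 hi with hi | rfl
    · rw [e i hi]
    · exact e'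

section Directed

variable [IsDirectedOrder Ω]

theorem exists_lift_ge (D : IsDirectLimit φ ψ) (l : Ω) (r : R) :
    ∃ m, l ≤ m ∧ ∃ a : A m, ψ m a = r := by
  obtain ⟨k, a, rfl⟩ := D.surj r
  obtain ⟨m, h, h'⟩ := exists_ge_ge l k
  exact ⟨m, h, φ k m h' a, D.map_limit k m h' a⟩

theorem exists_eq (D : IsDirectLimit φ ψ) {l m : Ω} {a : A l} {b : A m} (h : ψ l a = ψ m b) :
    ∃ k, ∃ hl : l ≤ k, ∃ hm : m ≤ k, φ l k hl a = φ m k hm b := by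
  obtain ⟨k, hl, hm⟩ := exists_ge_ge l m
  obtain ⟨k', hk, e⟩ := D.inj k (φ l k hl a) (φ m k hm b)
    (by rw [D.map_limit, D.map_limit, h])
  exact ⟨k', hl.trans hk, hm.trans hk, by rw [← D.map_map _ _ _ hl hk, e, D.map_map]⟩

/-- Finitely many elements of a direct limit lift to a common stage. -/
theorem exists_lift_fin [Nonempty Ω] (D : IsDirectLimit φ ψ) :
    ∀ (n : ℕ) (r : ℕ → R), ∃ l, ∃ a : ℕ → A l, ∀ i, i < n → ψ l (a i) = r i := by
  intro n r
  induction n with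
  | zero => exact ⟨Classical.arbitrary Ω, 0, fun i h => absurd h (Nat.not_lt_zero i)⟩
  | succ n ih =>
    obtain ⟨l, a, ha⟩ := ih
    obtain ⟨m, hm, b, hb⟩ := D.exists_lift_ge l (r n)
    refine ⟨m, fun i => if i < n then φ l m hm (a i) else b, fun i hi => ?_⟩
    dsimp only
    split_ifs with h
    · rw [D.map_limit, ha i h]
    · obtain rfl : i = n := by omega
      exact hb

/-- The functor `M_∞` commutes with direct limits. -/
theorem mInf [Nonempty Ω] (D : IsDirectLimit φ ψ) :
    IsDirectLimit (fun l m h => MInf.map (φ l m h)) (fun l => MInf.map (ψ l)) where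
  map_map l m k h h' a := by
    ext i j
    exact D.map_map l m k h h' _
  map_limit l m h a := by
    ext i j
    exact D.map_limit l m h _
  surj x := by
    obtain ⟨n, hn⟩ := x.finite
    -- The `n × n` corner is listed row by row: the entry `(i, j)` has index `j + n * i`, recovered
    -- by `/ n` and `% n`.
    obtain ⟨l, a, ha⟩ := D.exists_lift_fin (n * n) fun i => x (i / n) (i % n)
    refine ⟨l, ⟨fun i j => if i < n ∧ j < n then a (j + n * i) else 0, n, fun i j h => ?_⟩, ?_⟩
    · dsimp only
      rw [if_neg (by omega)]
    · ext i j
      change ψ l (if i < n ∧ j < n then a (j + n * i) else 0) = x i j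
      split_ifs with h
      · have h0 : 0 < n := by omega
        have : j + n * i < n * n := by
          have := Nat.mul_le_mul_left n (Nat.succ_le_of_lt h.1)
          rw [Nat.mul_succ] at this
          omega
        rw [ha _ this, Nat.add_mul_div_left _ _ h0, Nat.div_eq_of_lt h.2, Nat.zero_add,
          Nat.add_mul_mod_self_left, Nat.mod_eq_of_lt h.2]
      · rw [map_zero, hn i j (by omega)]
  inj l x y h := by
    obtain ⟨n, hx, hy, -⟩ := MInf.exists_common x y x
    obtain ⟨m, hm, e⟩ := D.exists_eq_fin (a := fun i => x (i / n) (i % n))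
      (b := fun i => y (i / n) (i % n)) (n * n) fun i _ =>
        congrArg (fun z : MInf R => z (i / n) (i % n)) h
    refine ⟨m, hm, ?_⟩
    ext i j
    change φ l m hm (x i j) = φ l m hm (y i j)
    by_cases h : i < n ∧ j < n
    · have h0 : 0 < n := by omega
      have : j + n * i < n * n := by
        have := Nat.mul_le_mul_left n (Nat.succ_le_of_lt h.1)
        rw [Nat.mul_succ] at this
        omega
      have := e _ this
      rwa [Nat.add_mul_div_left _ _ h0, Nat.div_eq_of_lt h.2, Nat.zero_add,
        Nat.add_mul_mod_self_left, Nat.mod_eq_of_lt h.2] at this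
    · rw [hx i j (by omega), hy i j (by omega)]

/-- The relation `≾₁` in a direct limit comes from some stage. -/
theorem exists_sub1 (D : IsDirectLimit φ ψ) {x y : R} (h : x ≾₁ y) :
    ∃ l, ∃ a b : A l, ψ l a = x ∧ ψ l b = y ∧ a ≾₁ b := by
  obtain ⟨s, t, rfl⟩ := h
  obtain ⟨l, b, rfl⟩ := D.surj y
  obtain ⟨m, hm, s, rfl⟩ := D.exists_lift_ge l s
  obtain ⟨k, hk, t, rfl⟩ := D.exists_lift_ge m t
  -- The lift of `x` is defined as the product of the lifts of its factors, so the factorisation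
  -- holds at stage `k` by construction and no equation has to be transported.
  refine ⟨k, φ m k hk s * φ l k (hm.trans hk) b * t, φ l k (hm.trans hk) b, ?_,
    D.map_limit _ _ _ _, ⟨_, _, rfl⟩⟩
  rw [map_mul, map_mul, D.map_limit, D.map_limit]

/-- A direct limit of dense rings is dense. -/
theorem isDenseRing [Nonempty Ω] (D : IsDirectLimit φ ψ) (hA : ∀ l, IsDenseRing (A l)) :
    IsDenseRing R := by
  intro x y h
  obtain ⟨l, a, b, rfl, rfl, hab⟩ := D.mInf.exists_sub1 h
  obtain ⟨z, h1, h2⟩ := hA l a b hab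
  exact ⟨MInf.map (ψ l) z, h1.map _, h2.map _⟩

end Directed

end IsDirectLimit

/-! ### Colimits in the category of rings -/

/-- The ring homomorphism underlying a morphism in the category of rings. -/
def Rings.toRingHom {A B : Rings.{u}} (f : A ⟶ B) : A.carrier →ₙ+* B.carrier := f

theorem Rings.toRingHom_congr {A B : Rings.{u}} {f g : A ⟶ B} (h : f = g) (a : A.carrier) :
    toRingHom f a = toRingHom g a := by rw [h]

/-- Colimits in the category of rings over a directed set are direct limits. -/
theorem isDirectLimit_of_isColimit {Ω : Type v} [Preorder Ω] [IsDirectedOrder Ω] [Nonempty Ω]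
    (G : Ω ⥤ Rings.{max u v}) (c : Cocone G) (hc : IsColimit c) :
    IsDirectLimit (A := fun l => (G.obj l).carrier)
      (fun _ _ h => Rings.toRingHom (G.map (homOfLE h))) (R := c.pt.carrier)
      (fun l => Rings.toRingHom (c.ι.app l)) := by
  let A : Ω → Type (max u v) := fun l => (G.obj l).carrier
  let φ : ∀ l m, l ≤ m → A l →ₙ+* A m := fun l m h => Rings.toRingHom (G.map (homOfLE h))
  let ψ : ∀ l, A l →ₙ+* c.pt.carrier := fun l => Rings.toRingHom (c.ι.app l)
  have map_map : ∀ l m k (h : l ≤ m) (h' : m ≤ k) (a : A l),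
      φ m k h' (φ l m h a) = φ l k (h.trans h') a := fun l m k h h' a =>
    (Rings.toRingHom_congr (G.map_comp (homOfLE h) (homOfLE h')) a).symm
  have map_limit : ∀ l m (h : l ≤ m) (a : A l), ψ m (φ l m h a) = ψ l a := fun l m h a =>
    Rings.toRingHom_congr (c.w (homOfLE h)) a
  have : DirectedSystem A (φ · · ·) :=
    ⟨fun i x => Rings.toRingHom_congr (G.map_id i) x,
      fun k j i hij hjk x => map_map _ _ _ hij hjk x⟩
  -- The concrete direct limit is a quotient of the disjoint union over `Ω`; with rings in universe
  -- `max u v` it stays in the same category.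
  let L : Rings.{max u v} := ⟨DirectLimit A φ⟩
  let d : Cocone G :=
    { pt := L
      ι :=
        { app := fun l => DirectLimit.NonUnitalRing.of A φ l
          naturality := fun l m f => by
            refine NonUnitalRingHom.ext fun a => ?_
            exact DirectLimit.NonUnitalRing.of_f (f := φ) f.le a } }
  let q : L ⟶ c.pt := DirectLimit.NonUnitalRing.lift A φ c.pt.carrier ψ map_limit
  have hp : ∀ l (a : A l), Rings.toRingHom (hc.desc d) (ψ l a) =
      DirectLimit.NonUnitalRing.of A φ l a := fun l a => Rings.toRingHom_congr (hc.fac d l) a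
  -- One composite suffices. Since `r = q (p r)` with `p = hc.desc d`, surjectivity is inherited
  -- from the concrete limit; applying `p` to an equality in `c.pt` moves it to the concrete limit,
  -- where it holds at some stage.
  have hq : hc.desc d ≫ q = 𝟙 c.pt := hc.hom_ext fun l => by
    refine NonUnitalRingHom.ext fun a => ?_
    change Rings.toRingHom q (Rings.toRingHom (hc.desc d) (ψ l a)) = ψ l a
    rw [hp]
    rfl
  refine ⟨map_map, map_limit, fun r => ?_, fun l a b h => ?_⟩
  · have hr : Rings.toRingHom q (Rings.toRingHom (hc.desc d) r) = r :=
      Rings.toRingHom_congr hq r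
    obtain ⟨l, a, ha⟩ := DirectLimit.exists_eq_mk φ (Rings.toRingHom (hc.desc d) r)
    refine ⟨l, a, ?_⟩
    rw [← hr, ha]
    rfl
  · have e := congrArg (Rings.toRingHom (hc.desc d)) h
    have e' : DirectLimit.NonUnitalRing.of A φ l a = DirectLimit.NonUnitalRing.of A φ l b :=
      (hp l a).symm.trans (e.trans (hp l b))
    obtain ⟨m, h1, _, h2⟩ := Quotient.exact e'
    exact ⟨m, h1, h2⟩

/-- Turns a bound of the form `y * x`, as left normality supplies it, into a bound by the term `x`
of a sequence. -/
theorem Sub1.of_mul {A : Type u} [NonUnitalRing A] {w y x : A} (h : w ≾₁ y * x) : w ≾₁ x := by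
  obtain ⟨s, t, rfl⟩ := h
  exact ⟨s * y, t, by simp only [mul_assoc]⟩

/-! ### Interpolation by elements of `S(R)` in left normal rings -/

/-- Left normality can be iterated: fed with `d = e d`, `e = c e` it returns a pair `d'`, `e'` of
the same kind with `d = d' d`. The resulting sequence has `x_n = x_{n+1} x_n` and is fixed by left
multiplication by `c`. -/
theorem IsLeftNormal.exists_mem_subS {R : Type u} [NonUnitalRing R] (hR : IsLeftNormal R)
    {a b c : MInf R} (hab : a = b * a) (hbc : b = c * b) :
    ∃ D ∈ subS R, Lam.Below a D ∧ ∀ w, Lam.Below w D → w ≾₁ c := by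
  obtain ⟨d, e, had, hde, hec⟩ := hR a b c hab hbc
  have step : ∀ p : {p : MInf R × MInf R // p.1 = p.2 * p.1 ∧ p.2 = c * p.2},
      ∃ q : {p : MInf R × MInf R // p.1 = p.2 * p.1 ∧ p.2 = c * p.2},
        p.1.1 = q.1.1 * p.1.1 := by
    rintro ⟨⟨d, e⟩, h1, h2⟩
    obtain ⟨d', e', h3, h4, h5⟩ := hR d e c h1 h2
    exact ⟨⟨(d', e'), h4, h5⟩, h3⟩
  choose nxt hn using step
  let p : ℕ → {p : MInf R × MInf R // p.1 = p.2 * p.1 ∧ p.2 = c * p.2} :=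
    fun n => Nat.rec ⟨(d, e), hde, hec⟩ (fun _ q => nxt q) n
  let x : ℕ → MInf R := fun n => (p n).1.1
  have hx : ∀ n, x n = x (n + 1) * x n := fun n => hn (p n)
  have hc : ∀ n, x n = c * x n := fun n => by
    change (p n).1.1 = c * (p n).1.1
    obtain ⟨⟨d, e⟩, h1, h2⟩ := p n
    dsimp only at h1 h2 ⊢
    conv_rhs => rw [h1, ← mul_assoc, ← h2, ← h1]
  -- Without a unit, `x_n = x_{n+1} x_n` does not display `x_n ≾₁ x_{n+1}`. The extra factor
  -- `x_{n+2}` provides the missing left multiplier, and also the `y_{n+1}` required by `𝒮(R)`.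
  have hx' : ∀ n, x n = x (n + 2) * x (n + 1) * x n := fun n => by
    rw [← hx (n + 1), ← hx n]
  refine ⟨Lam.mk ⟨x, fun n => ⟨_, _, hx' n⟩⟩, ⟨_, fun n => ⟨_, hx' n⟩, rfl⟩,
    Lam.below_mk.2 ⟨0, x 1, a, ?_⟩, fun w hw => ?_⟩
  · change a = x 1 * x 0 * a
    have h0 : x 0 = x 1 * x 0 := hx 0
    rw [← h0]
    exact had
  · obtain ⟨n, hn⟩ := Lam.below_mk.1 hw
    -- Again a left multiplier is needed, so `c` is used twice: `x_n = c c x_n`.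
    refine hn.trans ⟨c, x n, ?_⟩
    change x n = c * c * x n
    rw [mul_assoc, ← hc, ← hc]

/-! ### Auxiliary facts on `≪` and on induced maps -/

theorem WayBelow.le {S : Type u} [PartialOrder S] {x y : S} (h : WayBelow x y) : x ≤ y := by
  obtain ⟨-, h⟩ := h (fun _ => y) monotone_const y (by simp [isLUB_singleton]) le_rfl
  exact h

theorem WayBelow.mono {S : Type u} [PartialOrder S] {x' x y y' : S} (h : WayBelow x y)
    (hx : x' ≤ x) (hy : y ≤ y') : WayBelow x' y' := fun z hz s hs hle =>
  (h z hz s hs (hy.trans hle)).imp fun _ hm => hx.trans hm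

namespace Lam

theorem map_map_of_eq {R : Type u} {R' : Type v} {R'' : Type w} [NonUnitalRing R]
    [NonUnitalRing R'] [NonUnitalRing R''] {f : R →ₙ+* R'} {g : R' →ₙ+* R''} {k : R →ₙ+* R''}
    (h : ∀ r, g (f r) = k r) (a : Lam R) : map g (map f a) = map k a := by
  obtain ⟨x, rfl⟩ := mk_surjective a
  simp only [map_mk]
  congr 1
  simp only [IncSeq.map, IncSeq.mk.injEq]
  funext n
  ext i j
  exact h _

/-- A matrix below an image need not be an image itself, but it lies `≾₁`-below the image of a term
of a representing sequence, and the bound applies to that term. -/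
theorem sub_map_of_below {R : Type u} {R' : Type v} [NonUnitalRing R] [NonUnitalRing R']
    (f : R →ₙ+* R') {a : Lam R} {v : MInf R} (h : ∀ w, Below w a → w ≾₁ v) {w : MInf R'}
    (hw : Below w (map f a)) : w ≾₁ MInf.map f v := by
  obtain ⟨x, rfl⟩ := mk_surjective a
  obtain ⟨n, hn⟩ := below_mk.1 hw
  exact hn.trans ((h _ (below_seq x n)).map _)

end Lam

/-! ### The semigroup `Λ` of a direct limit -/

section DirectLimit

variable {Ω : Type v} [Preorder Ω] {A : Ω → Type w} [∀ l, NonUnitalRing (A l)]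
  (φ : ∀ l m, l ≤ m → A l →ₙ+* A m) {R : Type w'} [NonUnitalRing R] (ψ : ∀ l, A l →ₙ+* R)

/-- The element `y` of `M_∞(R)` has a lift to some stage which bounds the image of `a`
with respect to `≾₁`. -/
def Bounds {l : Ω} (a : Lam (A l)) (y : MInf R) : Prop :=
  ∃ m, ∃ h : l ≤ m, ∃ v : MInf (A m), MInf.map (ψ m) v = y ∧
    ∀ w, Lam.Below w (Lam.map (φ l m h) a) → w ≾₁ v

/-- A presentation of an element of `Λ(R)` as the supremum of a rapidly increasing sequence
of images of elements of the semigroups `Λ(R_λ)`. -/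
structure Chain (a : Lam R) where
  /-- The stages. -/
  idx : ℕ → Ω
  /-- The elements at the stages. -/
  val : ∀ n, Lam (A (idx n))
  /-- The interpolating elements of `M_∞(R)`. -/
  mid : ℕ → MInf R
  mid_below : ∀ n, Lam.Below (mid n) a
  cofinal : ∀ u, Lam.Below u a → ∃ n, u ≾₁ mid n
  below_val : ∀ n, Lam.Below (mid n) (Lam.map (ψ (idx n)) (val n))
  bounds : ∀ n, Bounds φ ψ (val n) (mid (n + 1))

variable {φ ψ}

namespace IsDirectLimit

theorem lam_map_map (D : IsDirectLimit φ ψ) {l m k : Ω} (h : l ≤ m) (h' : m ≤ k)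
    (a : Lam (A l)) : Lam.map (φ m k h') (Lam.map (φ l m h) a) = Lam.map (φ l k (h.trans h')) a :=
  Lam.map_map_of_eq (D.map_map l m k h h') a

theorem lam_map_limit (D : IsDirectLimit φ ψ) {l m : Ω} (h : l ≤ m) (a : Lam (A l)) :
    Lam.map (ψ m) (Lam.map (φ l m h) a) = Lam.map (ψ l) a :=
  Lam.map_map_of_eq (D.map_limit l m h) a

theorem sub_of_bounds (D : IsDirectLimit φ ψ) {l : Ω} {a : Lam (A l)} {y w : MInf R}
    (h : Bounds φ ψ a y) (hw : Lam.Below w (Lam.map (ψ l) a)) : w ≾₁ y := by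
  obtain ⟨m, hm, v, rfl, hv⟩ := h
  rw [← D.lam_map_limit hm] at hw
  exact Lam.sub_map_of_below _ hv hw

variable [IsDirectedOrder Ω] [Nonempty Ω]

/-- Membership is witnessed by `y = s ψ(x_n) t`. It suffices to lift `s` and `t` and to form the
product at their common stage. -/
theorem exists_below (D : IsDirectLimit φ ψ) {l : Ω} {a : Lam (A l)} {y : MInf R}
    (h : Lam.Below y (Lam.map (ψ l) a)) :
    ∃ m, ∃ hm : l ≤ m, ∃ v : MInf (A m), MInf.map (ψ m) v = y ∧
      Lam.Below v (Lam.map (φ l m hm) a) := by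
  obtain ⟨x, rfl⟩ := Lam.mk_surjective a
  obtain ⟨n, s, t, rfl⟩ := Lam.below_mk.1 h
  obtain ⟨m, hm, s, rfl⟩ := D.mInf.exists_lift_ge l s
  obtain ⟨k, hk, t, rfl⟩ := D.mInf.exists_lift_ge m t
  refine ⟨k, hm.trans hk, MInf.map (φ m k hk) s * MInf.map (φ l k (hm.trans hk)) (x.seq n) * t,
    ?_, Lam.below_mk.2 ⟨n, _, _, rfl⟩⟩
  rw [map_mul, map_mul, D.mInf.map_limit, D.mInf.map_limit]
  rfl

/-- If `y` bounds `a` and lies below the image of `b`, then `a ≪ b` at some stage. -/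
theorem exists_wayBelow (D : IsDirectLimit φ ψ) {l l' : Ω} {a : Lam (A l)} {b : Lam (A l')}
    {y : MInf R} (ha : Bounds φ ψ a y) (hb : Lam.Below y (Lam.map (ψ l') b)) :
    ∃ k, ∃ h : l ≤ k, ∃ h' : l' ≤ k,
      WayBelow (Lam.map (φ l k h) a) (Lam.map (φ l' k h') b) := by
  obtain ⟨m, hm, v, rfl, hv⟩ := ha
  obtain ⟨m', hm', v', e, hv'⟩ := D.exists_below hb
  -- Both `v` and `v'` lift the same matrix `y`, hence agree at a later stage `k`; there one matrix
  -- dominates `a` and is below `b`.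
  obtain ⟨k, hk, hk', e⟩ := D.mInf.exists_eq e
  refine ⟨k, hm.trans hk', hm'.trans hk, Lam.wayBelow_of_sub (u := MInf.map (φ m' k hk) v') ?_ ?_⟩
  · rw [← D.lam_map_map hm' hk]
    exact hv'.map _
  · intro w hw
    rw [← D.lam_map_map hm hk'] at hw
    rw [e]
    exact Lam.sub_map_of_below _ hv hw

/-- Density is applied at the stage to which the relation lifts, so the interpolating element is
dominated by a lift of `y` already there. -/
theorem exists_bounds (D : IsDirectLimit φ ψ) (hA : ∀ l, IsDenseRing (A l)) {x y : MInf R}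
    (h : x ≾₁ y) : ∃ l, ∃ a : Lam (A l), Lam.Below x (Lam.map (ψ l) a) ∧ Bounds φ ψ a y := by
  obtain ⟨l, u, v, rfl, rfl, h'⟩ := D.mInf.exists_sub1 h
  obtain ⟨z, h1, h2⟩ := Lam.exists_between (hA l) h'
  -- `IsDirectLimit` does not include `φ l l = id`, so `v` is replaced by its image under `φ l l`,
  -- which has the same limit.
  refine ⟨l, Lam.mk z, h1.map _, l, le_rfl, MInf.map (φ l l le_rfl) v, ?_, fun w hw => ?_⟩
  · exact D.mInf.map_limit l l le_rfl v
  · exact Lam.sub_map_of_below _ h2 hw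

theorem exists_chain (D : IsDirectLimit φ ψ) (hA : ∀ l, IsDenseRing (A l)) (a : Lam R) :
    Nonempty (Chain φ ψ a) := by
  obtain ⟨x, rfl⟩ := Lam.mk_surjective a
  choose l a h1 h2 using fun n => D.exists_bounds hA (x.step n)
  exact ⟨⟨l, a, x.seq, Lam.below_seq x, fun u hu => Lam.below_mk.1 hu, h1, h2⟩⟩

/-- Interpolation of a piece of a sequence in `𝒮(R)` by an element of some `S(R_λ)`. -/
theorem exists_bounds_mem (D : IsDirectLimit φ ψ) (hN : ∀ l, IsLeftNormal (A l)) {x : IncSeq R}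
    (hx : x.IsS) (n : ℕ) : ∃ l, ∃ a ∈ subS (A l),
      Lam.Below (x.seq n) (Lam.map (ψ l) a) ∧ Bounds φ ψ a (x.seq (n + 3)) := by
  obtain ⟨y, hy⟩ := hx n
  obtain ⟨y', hy'⟩ := hx (n + 1)
  obtain ⟨y'', hy''⟩ := hx (n + 2)
  -- The data for left normality are `a = x_{n+2} x_{n+1}`, `b = x_{n+2} y'` and `c = y'' x_{n+3}`;
  -- `e1` and `e2` say `a = b a` and `b = c b`, and `e3` places `x_n` below `a`.
  have e1 : x.seq (n + 2) * x.seq (n + 1) =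
      x.seq (n + 2) * y' * (x.seq (n + 2) * x.seq (n + 1)) := by
    conv_lhs => rw [hy']
    simp only [mul_assoc]
  have e2 : x.seq (n + 2) * y' = y'' * x.seq (n + 3) * (x.seq (n + 2) * y') := by
    conv_lhs => rw [hy'']
    simp only [mul_assoc]
  have e3 : x.seq n ≾₁ x.seq (n + 2) * x.seq (n + 1) := by
    refine ⟨y * y', x.seq n, ?_⟩
    conv_lhs => rw [hy, hy']
    simp only [mul_assoc]
  -- Only the indices below 4 matter; the default `0` fills up the sequence.
  obtain ⟨l, r, hr⟩ := D.mInf.exists_lift_fin 4 fun i =>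
    [x.seq (n + 2) * x.seq (n + 1), x.seq (n + 2) * y', y'', x.seq (n + 3)].getD i 0
  have r0 : MInf.map (ψ l) (r 0) = x.seq (n + 2) * x.seq (n + 1) := hr 0 (by norm_num)
  have r1 : MInf.map (ψ l) (r 1) = x.seq (n + 2) * y' := hr 1 (by norm_num)
  have r2 : MInf.map (ψ l) (r 2) = y'' := hr 2 (by norm_num)
  have r3 : MInf.map (ψ l) (r 3) = x.seq (n + 3) := hr 3 (by norm_num)
  obtain ⟨m, hm, f1, f2⟩ := D.mInf.exists_eq_eq (a := r 0) (b := r 1 * r 0) (a' := r 1)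
    (b' := r 2 * r 3 * r 1) (by rw [map_mul, r0, r1]; exact e1)
    (by rw [map_mul, map_mul, r1, r2, r3]; exact e2)
  rw [map_mul] at f1
  rw [map_mul, map_mul] at f2
  obtain ⟨d, hd, h1, h2⟩ := (hN m).exists_mem_subS f1 f2
  refine ⟨m, d, hd, (h1.map (ψ m)).of_sub ?_, m, le_rfl,
    MInf.map (φ m m le_rfl) (MInf.map (φ l m hm) (r 3)), ?_, fun w hw =>
    Lam.sub_map_of_below _ (fun w hw => (h2 w hw).of_mul) hw⟩
  · rw [D.mInf.map_limit, r0]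
    exact e3
  · rw [D.mInf.map_limit, D.mInf.map_limit, r3]

/-- An element of `S(R)` has a presentation by elements of the `S(R_λ)`. -/
theorem exists_chain_mem (D : IsDirectLimit φ ψ) (hN : ∀ l, IsLeftNormal (A l)) {a : Lam R}
    (ha : a ∈ subS R) : ∃ C : Chain φ ψ a, ∀ n, C.val n ∈ subS (A (C.idx n)) := by
  obtain ⟨x, hx, rfl⟩ := ha
  -- Each interpolation uses up three steps of the sequence, so every third term is sampled.
  choose l a h h1 h2 using fun n => D.exists_bounds_mem hN hx (3 * n)
  exact ⟨⟨l, a, fun n => x.seq (3 * n), fun n => Lam.below_seq x _, fun u hu => by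
    obtain ⟨n, hn⟩ := Lam.below_mk.1 hu
    exact ⟨n + 1, hn.trans (x.lt (by omega))⟩, h1, h2⟩, h⟩

end IsDirectLimit

namespace Chain

/-- The image of `val n` is sandwiched: `mid n` is below it, and everything below it is `≾₁ mid (n +
1)`. The matrices `mid n` are cofinal below `a`. -/
theorem isLUB_map (D : IsDirectLimit φ ψ) {a : Lam R} (C : Chain φ ψ a) :
    IsLUB (Set.range fun n => Lam.map (ψ (C.idx n)) (C.val n)) a :=
  Lam.isLUB_of_below fun u => by
    constructor
    · intro hu
      obtain ⟨n, hn⟩ := C.cofinal u hu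
      exact ⟨n, (C.below_val n).of_sub hn⟩
    · rintro ⟨n, hn⟩
      exact (C.mid_below (n + 1)).of_sub (D.sub_of_bounds (C.bounds n) hn)

theorem monotone_map (D : IsDirectLimit φ ψ) {a : Lam R} (C : Chain φ ψ a) :
    Monotone fun n => Lam.map (ψ (C.idx n)) (C.val n) :=
  monotone_nat_of_le_succ fun n => Lam.le_iff_below.2 fun _ hu =>
    (C.below_val (n + 1)).of_sub (D.sub_of_bounds (C.bounds n) hu)

end Chain

end DirectLimit

/-! ### The universal property -/

section Universal

variable {Ω : Type v} [Preorder Ω] {A : Ω → Type w} [∀ l, NonUnitalRing (A l)]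

/-- A compatible family of morphisms from the pairs `(Λ(R_λ), S(R_λ))` to an object of `SCu`. -/
structure LamCocone (φ : ∀ l m, l ≤ m → A l →ₙ+* A m) (T : SCu.{z}) where
  /-- The underlying monoid homomorphisms. -/
  app : ∀ l, Lam (A l) →+ T.S
  app_map : ∀ l m (h : l ≤ m) (a : Lam (A l)), app m (Lam.map (φ l m h) a) = app l a
  monotone : ∀ l, Monotone (app l)
  wayBelow : ∀ l a b, WayBelow a b → WayBelow (app l a) (app l b)
  isLUB : ∀ l (a : ℕ → Lam (A l)), Monotone a → ∀ s, IsLUB (Set.range a) s →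
    IsLUB (Set.range fun n => app l (a n)) (app l s)
  mem : ∀ l, ∀ a ∈ subS (A l), app l a ∈ T.W

variable {φ : ∀ l m, l ≤ m → A l →ₙ+* A m} {R : Type w'} [NonUnitalRing R]
  {ψ : ∀ l, A l →ₙ+* R} {T : SCu.{z}}

namespace LamCocone

variable (ψ) in
/-- The values of a cocone on the elements which are bounded by some element below `a`. -/
def values (K : LamCocone φ T) (a : Lam R) : Set T.S :=
  {s | ∃ l, ∃ b : Lam (A l), ∃ y, Lam.Below y a ∧ Bounds φ ψ b y ∧ K.app l b = s}

theorem values_mono (K : LamCocone φ T) {a b : Lam R} (h : a ≤ b) :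
    K.values ψ a ⊆ K.values ψ b := by
  rintro _ ⟨l, c, y, hy, hc, rfl⟩
  exact ⟨l, c, y, hy.of_le h, hc, rfl⟩

theorem app_val_mem_values (K : LamCocone φ T) {a : Lam R} (C : Chain φ ψ a) (n : ℕ) :
    K.app _ (C.val n) ∈ K.values ψ a :=
  ⟨_, _, _, C.mid_below (n + 1), C.bounds n, rfl⟩

variable [IsDirectedOrder Ω] [Nonempty Ω]

/-- The comparison is made at a common later stage; compatibility of the cocone brings it back to
the original elements. -/
theorem wayBelow_of_bounds (K : LamCocone φ T) (D : IsDirectLimit φ ψ) {l l' : Ω}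
    {a : Lam (A l)} {b : Lam (A l')} {y : MInf R} (ha : Bounds φ ψ a y)
    (hb : Lam.Below y (Lam.map (ψ l') b)) : WayBelow (K.app l a) (K.app l' b) := by
  obtain ⟨k, h, h', hab⟩ := D.exists_wayBelow ha hb
  rw [← K.app_map l k h, ← K.app_map l' k h']
  exact K.wayBelow k _ _ hab

theorem wayBelow_val_succ (K : LamCocone φ T) (D : IsDirectLimit φ ψ) {a : Lam R}
    (C : Chain φ ψ a) (n : ℕ) : WayBelow (K.app _ (C.val n)) (K.app _ (C.val (n + 1))) :=
  K.wayBelow_of_bounds D (C.bounds n) (C.below_val (n + 1))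

theorem monotone_val (K : LamCocone φ T) (D : IsDirectLimit φ ψ) {a : Lam R}
    (C : Chain φ ψ a) : Monotone fun n => K.app _ (C.val n) :=
  monotone_nat_of_le_succ fun n => (K.wayBelow_val_succ D C n).le

theorem exists_le_val (K : LamCocone φ T) (D : IsDirectLimit φ ψ) {a : Lam R}
    (C : Chain φ ψ a) {s : T.S} (hs : s ∈ K.values ψ a) : ∃ n, s ≤ K.app _ (C.val n) := by
  obtain ⟨l, b, y, hy, hb, rfl⟩ := hs
  obtain ⟨n, hn⟩ := C.cofinal y hy
  exact ⟨n, (K.wayBelow_of_bounds D hb ((C.below_val n).of_sub hn)).le⟩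

/-- The values along a chain are cofinal in the canonical set: the supremum exists because of the
chain and does not depend on it. -/
theorem upperBounds_values (K : LamCocone φ T) (D : IsDirectLimit φ ψ) {a : Lam R}
    (C : Chain φ ψ a) :
    upperBounds (K.values ψ a) = upperBounds (Set.range fun n => K.app _ (C.val n)) := by
  ext t
  constructor
  · rintro h _ ⟨n, rfl⟩
    exact h (K.app_val_mem_values C n)
  · intro h s hs
    obtain ⟨n, hn⟩ := K.exists_le_val D C hs
    exact hn.trans (h ⟨n, rfl⟩)

theorem exists_isLUB_values (K : LamCocone φ T) (D : IsDirectLimit φ ψ)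
    (hA : ∀ l, IsDenseRing (A l)) (a : Lam R) : ∃ s, IsLUB (K.values ψ a) s := by
  obtain ⟨C⟩ := D.exists_chain hA a
  obtain ⟨s, hs⟩ := CuSemigroup.exists_isLUB _ (K.monotone_val D C)
  exact ⟨s, by rwa [IsLUB, K.upperBounds_values D C]⟩

/-! ### The induced map out of `Λ(R)` -/

variable (K : LamCocone φ T) (D : IsDirectLimit φ ψ) (hA : ∀ l, IsDenseRing (A l))

/-- The map from `Λ(R)` induced by a cocone. -/
noncomputable def descFun (a : Lam R) : T.S := (K.exists_isLUB_values D hA a).choose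

theorem isLUB_descFun (a : Lam R) : IsLUB (K.values ψ a) (K.descFun D hA a) :=
  (K.exists_isLUB_values D hA a).choose_spec

theorem isLUB_descFun_chain {a : Lam R} (C : Chain φ ψ a) :
    IsLUB (Set.range fun n => K.app _ (C.val n)) (K.descFun D hA a) := by
  rw [IsLUB, ← K.upperBounds_values D C]
  exact K.isLUB_descFun D hA a

theorem descFun_mono : Monotone (K.descFun D hA) := fun _ _ h =>
  (K.isLUB_descFun D hA _).mono (K.isLUB_descFun D hA _) (K.values_mono h)

/-- Every competing value is `≪ K.app l a`. Conversely, a rapidly increasing sequence for `a` at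
stage `l` consists of elements bounded by terms below `a`, and `K.app l` preserves its supremum. -/
theorem descFun_map (l : Ω) (a : Lam (A l)) : K.descFun D hA (Lam.map (ψ l) a) = K.app l a := by
  apply le_antisymm
  · refine (K.isLUB_descFun D hA _).2 ?_
    rintro _ ⟨m, b, y, hy, hb, rfl⟩
    exact (K.wayBelow_of_bounds D hb hy).le
  · obtain ⟨x, rfl⟩ := Lam.mk_surjective a
    obtain ⟨b, hb, hs, h1, -⟩ := Lam.exists_rapid (hA l) x
    refine (K.isLUB l b hb _ hs).2 ?_
    rintro _ ⟨n, rfl⟩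
    refine (K.isLUB_descFun D hA _).1 ⟨l, b n, MInf.map (ψ l) (x.seq (n + 1)),
      (Lam.below_seq x _).map _, ⟨l, le_rfl, MInf.map (φ l l le_rfl) (x.seq (n + 1)),
        D.mInf.map_limit _ _ _ _, fun w hw => Lam.sub_map_of_below _ (h1 n) hw⟩, rfl⟩

/-- A matrix below the supremum is below some `a n`, so each value admitted for `s` is already
admitted for some `a n`. -/
theorem isLUB_descFun_range {a : ℕ → Lam R} (ha : Monotone a) {s : Lam R}
    (hs : IsLUB (Set.range a) s) :
    IsLUB (Set.range fun n => K.descFun D hA (a n)) (K.descFun D hA s) := by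
  constructor
  · rintro _ ⟨n, rfl⟩
    exact K.descFun_mono D hA (hs.1 ⟨n, rfl⟩)
  · intro t ht
    refine (K.isLUB_descFun D hA s).2 ?_
    rintro _ ⟨l, b, y, hy, hb, rfl⟩
    obtain ⟨n, hn⟩ := (Lam.below_isLUB ha hs y).1 hy
    exact ((K.isLUB_descFun D hA (a n)).1 ⟨l, b, y, hn, hb, rfl⟩).trans (ht ⟨n, rfl⟩)

theorem descFun_add_map (D : IsDirectLimit φ ψ) (hA : ∀ l, IsDenseRing (A l)) {l m : Ω}
    (a : Lam (A l)) (b : Lam (A m)) :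
    K.descFun D hA (Lam.map (ψ l) a + Lam.map (ψ m) b) = K.app l a + K.app m b := by
  obtain ⟨k, h, h'⟩ := exists_ge_ge l m
  rw [← D.lam_map_limit h, ← D.lam_map_limit h', ← map_add, K.descFun_map, map_add, K.app_map,
    K.app_map]

/-- Both sides are suprema of the same sequence, the sums of the values along two chains: on the
left by continuity and additivity at a common stage, on the right by (O4) in `T`. -/
theorem descFun_add (a b : Lam R) :
    K.descFun D hA (a + b) = K.descFun D hA a + K.descFun D hA b := by
  obtain ⟨C⟩ := D.exists_chain hA a
  obtain ⟨C'⟩ := D.exists_chain hA b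
  have h1 := K.isLUB_descFun_range D hA
    (fun i j h => add_le_add (C.monotone_map D h) (C'.monotone_map D h))
    (Lam.isLUB_add (C.monotone_map D) (C'.monotone_map D) (C.isLUB_map D) (C'.isLUB_map D))
  have h2 := CuSemigroup.isLUB_add _ _ (K.monotone_val D C) (K.monotone_val D C') _ _
    (K.isLUB_descFun_chain D hA C) (K.isLUB_descFun_chain D hA C')
  simp only [K.descFun_add_map] at h1
  exact h1.unique h2

/-- Testing `a ≪ b` on a chain for `b` puts `a` below the image of one `val n`, whose value is `≪`
the value of `val (n + 1)`. -/
theorem descFun_wayBelow {a b : Lam R} (h : WayBelow a b) :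
    WayBelow (K.descFun D hA a) (K.descFun D hA b) := by
  obtain ⟨C⟩ := D.exists_chain hA b
  obtain ⟨n, hn⟩ := h _ (C.monotone_map D) _ (C.isLUB_map D) le_rfl
  refine (K.wayBelow_val_succ D C n).mono ?_ ((K.isLUB_descFun_chain D hA C).1 ⟨n + 1, rfl⟩)
  rw [← K.descFun_map D hA]
  exact K.descFun_mono D hA hn

theorem descFun_mem (hN : ∀ l, IsLeftNormal (A l)) {a : Lam R} (ha : a ∈ subS R) :
    K.descFun D hA a ∈ T.W := by
  obtain ⟨C, hC⟩ := D.exists_chain_mem hN ha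
  have hs := K.isLUB_descFun_chain D hA C
  -- The values along the chain increase, so the sequence itself witnesses that it is weakly
  -- increasing.
  exact T.sup_mem _ (fun n => K.mem _ _ (hC n))
    ⟨_, K.monotone_val D C, fun m => ⟨m, fun _ h => K.monotone_val D C h⟩, _, hs,
      fun n => hs.1 ⟨n, rfl⟩⟩ _ hs

/-- The monoid homomorphism from `Λ(R)` induced by a cocone. -/
noncomputable def desc : Lam R →+ T.S where
  toFun := K.descFun D hA
  map_zero' := by
    rw [← map_zero (Lam.map (ψ (Classical.arbitrary Ω))), K.descFun_map, map_zero]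
  map_add' := K.descFun_add D hA

/-- A map preserving suprema is determined by its values on the images of the `Λ(R_λ)`. -/
theorem eq_desc (f : Lam R →+ T.S)
    (hf : ∀ x : ℕ → Lam R, Monotone x → ∀ s, IsLUB (Set.range x) s →
      IsLUB (Set.range fun n => f (x n)) (f s))
    (h : ∀ l a, f (Lam.map (ψ l) a) = K.app l a) : f = K.desc D hA := by
  ext a
  obtain ⟨C⟩ := D.exists_chain hA a
  have h1 := hf _ (C.monotone_map D) _ (C.isLUB_map D)
  simp only [h] at h1
  exact h1.unique (K.isLUB_descFun_chain D hA C)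

end LamCocone

end Universal

end CuntzRing

/-! ### The colimit theorem -/

theorem mainTheorem6 {Ω : Type v} [Preorder Ω] [IsDirectedOrder Ω] [Nonempty Ω]
    (F : Ω ⥤ CuntzRing.DenseRings.{max u v})
    (hF : ∀ l : Ω, CuntzRing.IsLeftNormal (F.obj l).obj)
    (c : Cocone (F ⋙ CuntzRing.denseProp.{max u v}.ι)) (hc : IsColimit c) :
    ∃ h : CuntzRing.IsDenseRing c.pt,
      Nonempty (IsColimit
        (CuntzRing.SCuFunctor.{max u v}.mapCocone (CuntzRing.denseCocone c h))) := by
  have D := CuntzRing.isDirectLimit_of_isColimit.{u, v} _ c hc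
  have hA : ∀ l, CuntzRing.IsDenseRing (F.obj l).obj := fun l => (F.obj l).property
  refine ⟨D.isDenseRing hA, ⟨?_⟩⟩
  -- A cocone in `SCu` unfolds to a compatible family of maps on the semigroups `Λ(R_λ)`, to which
  -- the elementwise construction applies.
  let K : ∀ s : Cocone (F ⋙ CuntzRing.SCuFunctor.{max u v}),
      CuntzRing.LamCocone (A := fun l => (F.obj l).obj.carrier)
        (fun _ _ h => CuntzRing.Rings.toRingHom (F.map (homOfLE h)).hom) s.pt := fun s =>
    { app := fun l => (s.ι.app l).toAddHom
      app_map := fun l m h a =>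
        congrArg (fun f : CuntzRing.SCu.Hom _ _ => f.toAddHom a) (s.w (homOfLE h))
      monotone := fun l => (s.ι.app l).monotone
      wayBelow := fun l => (s.ι.app l).wayBelow
      isLUB := fun l => (s.ι.app l).isLUB
      mem := fun l => (s.ι.app l).mem }
  exact
    { desc := fun s =>
        { toAddHom := (K s).desc D hA
          monotone := (K s).descFun_mono D hA
          wayBelow := fun _ _ h => (K s).descFun_wayBelow D hA h
          isLUB := fun _ hx _ hs => (K s).isLUB_descFun_range D hA hx hs
          mem := fun _ h => (K s).descFun_mem D hA hF h }
      fac := fun s l => CuntzRing.SCu.Hom.ext (AddMonoidHom.ext ((K s).descFun_map D hA l))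
      uniq := fun s f hf => CuntzRing.SCu.Hom.ext ((K s).eq_desc D hA f.toAddHom f.isLUB fun l a =>
        congrArg (fun f : CuntzRing.SCu.Hom _ _ => f.toAddHom a) (hf l)) }
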